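/- Let $\Omega\subset\mathbb R^2$ be a bounded open set, let $T,\xi,k>0$, and let $h:[0,\infty)\to\mathbb R$ be Lipschitz continuous with $\delta\le h(s)\le 1$ for all $s\ge 0$, for some $\delta>0$. Put $$G_\xi(x)=\frac{1}{\xi\sqrt{2\pi}}\,e^{-|x|^2/(2\xi^2)},\qquad (G_\xi*f)(x)=\int_\Omega G_\xi(x-y)f(y)\,dy,\qquad g(u)=\frac{1}{1+|G_\xi*u|/k^2}.$$ Let $I_0\in H^1(\Omega)$ and consider on $(0,T)\times\Omega$ the system $$\partial_t I=\operatorname{div}(g(u)\nabla I)-2v,\qquad \partial_t u=h(|\nabla (G_\xi*I)|^2)-u+\Delta u,\qquad \partial_t v=\Delta v-(I_0-I),$$ $$I(0)=I_0,\qquad u(0)=G_\xi*|\nabla I_0|^2,\qquad v(0)=0,$$ with homogeneous Neumann boundary conditions for $I$ and $u$ and the homogeneous Dirichlet condition for $v$. A weak solution is a triple $(I,u,v)$ such that (i) $I,u\in L^2(0,T;H^1(\Omega))$ with $\partial_t I,\partial_t u\in L^2(0,T;H^1(\Omega)')$, and $v\in L^2(0,T;H^1_0(\Omega))$ with $\partial_t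 v\in L^2(0,T;H^{-1}(\Omega))$; (ii) for all $\Psi\in L^2(0,T;H^1(\Omega))$ and $\Phi\in L^2(0,T;H^1_0(\Omega))$, $$\int_0^T\langle\partial_t I,\Psi\rangle\,dt+\int_0^T\!\!\int_\Omega g(u)\nabla I\cdot\nabla\Psi\,dx\,dt+2\int_0^T\!\!\int_\Omega v\Psi\,dx\,dt=0,$$ $$\int_0^T\langle\partial_t u,\Psi\rangle\,dt-\int_0^T\!\!\int_\Omega h(|\nabla (G_\xi*I)|^2)\Psi\,dx\,dt+\int_0^T\!\!\int_\Omega u\Psi\,dx\,dt+\int_0^T\!\!\int_\Omega\nabla u\cdot\nabla\Psi\,dx\,dt=0,$$ $$\int_0^T\langle\partial_t v,\Phi\rangle\,dt+\int_0^T\!\!\int_\Omega\nabla v\cdot\nabla\Phi\,dx\,dt+\int_0^T\!\!\int_\Omega(I_0-I)\Phi\,dx\,dt=0;$$ (iii) the initial conditions hold in $L^2(\Omega)$: each of $I,u,v$ tends in $L^2(\Omega)$, as $t\to0^+$ outside a null set of times, to its initial value (equivalently, its representative in $C([0,T];L^2(\Omega))$ takes that value at $t=0$). Then the weak solution is unique: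 if $(I_1,u_1,v_1)$ and $(I_2,u_2,v_2)$ are weak solutions with the same data, then $I_1=I_2$, $u_1=u_2$ and $v_1=v_2$ almost everywhere on $(0,T)$ (as functions with values in $H^1(\Omega)$, $H^1(\Omega)$ and $H^1_0(\Omega)$). -/

import Mathlib

open MeasureTheory Filter Set Topology
open scoped ENNReal NNReal ContDiff

noncomputable section

namespace CPDE

/-- The plane, with its Euclidean norm. -/
abbrev Plane : Type := EuclideanSpace ℝ (Fin 2)

/-- Smooth functions with compact support contained in `U`. -/
structure IsTestFunction {F : Type*} [NormedAddCommGroup F] [NormedSpace ℝ F]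
    (U : Set F) (φ : F → ℝ) : Prop where
  smooth : ContDiff ℝ ∞ φ
  compact : HasCompactSupport φ
  support : tsupport φ ⊆ U

/-- The real Hilbert space `L²(Ω)`. -/
abbrev L2 (Ω : Set Plane) : Type := Lp ℝ 2 (volume.restrict Ω)

/-- The real Hilbert space `L²(Ω; ℝ²)`. -/
abbrev L2vec (Ω : Set Plane) : Type := Lp Plane 2 (volume.restrict Ω)

/-- The Hilbert space `L²(Ω) × L²(Ω; ℝ²)` with `‖(f, F)‖² = ‖f‖² + ‖F‖²`. -/
abbrev Pair (Ω : Set Plane) : Type := WithLp 2 (L2 Ω × L2vec Ω)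

/-- `F` is the distributional gradient of `f` in `Ω`. -/
def IsWeakGradient (Ω : Set Plane) (f : Plane → ℝ) (F : Plane → Plane) : Prop :=
  ∀ φ : Plane → ℝ, IsTestFunction Ω φ → ∀ i : Fin 2,
    ∫ x in Ω, f x * fderiv ℝ φ x (EuclideanSpace.single i 1) = -∫ x in Ω, F x i * φ x

theorem IsTestFunction.memLp_fderiv {Ω : Set Plane} {φ : Plane → ℝ}
    (hφ : IsTestFunction Ω φ) (e : Plane) :
    MemLp (fun x => fderiv ℝ φ x e) 2 (volume.restrict Ω) := by
  refine MemLp.restrict Ω (Continuous.memLp_of_hasCompactSupport ?_ ?_)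
  · exact (hφ.smooth.continuous_fderiv (by simp)).clm_apply continuous_const
  · exact hφ.compact.fderiv_apply ℝ e

theorem IsTestFunction.memLp {Ω : Set Plane} {φ : Plane → ℝ}
    (hφ : IsTestFunction Ω φ) : MemLp φ 2 (volume.restrict Ω) :=
  MemLp.restrict Ω (hφ.smooth.continuous.memLp_of_hasCompactSupport hφ.compact)

theorem memLp_coord {Ω : Set Plane} (F : L2vec Ω) (i : Fin 2) :
    MemLp (fun x => F x i) 2 (volume.restrict Ω) :=
  ((EuclideanSpace.proj i : Plane →L[ℝ] ℝ)).comp_memLp' (Lp.memLp F)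

/-- The Sobolev space `H¹(Ω)`, as the space of pairs `(f, ∇f)` where `f ∈ L²(Ω)` has the
distributional gradient `∇f ∈ L²(Ω; ℝ²)`; its norm is `(‖f‖² + ‖∇f‖²)^(1/2)`. -/
def H1 (Ω : Set Plane) : Submodule ℝ (Pair Ω) where
  carrier := {w | IsWeakGradient Ω w.fst w.snd}
  zero_mem' := by
    intro φ hφ i
    have h1 : (fun x => (WithLp.fst (0 : Pair Ω)) x * fderiv ℝ φ x (EuclideanSpace.single i 1))
        =ᵐ[volume.restrict Ω] 0 := by
      filter_upwards [Lp.coeFn_zero ℝ 2 (volume.restrict Ω)] with x hx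
      rw [WithLp.zero_fst, hx]
      simp
    have h2 : (fun x => (WithLp.snd (0 : Pair Ω)) x i * φ x) =ᵐ[volume.restrict Ω] 0 := by
      filter_upwards [Lp.coeFn_zero Plane 2 (volume.restrict Ω)] with x hx
      rw [WithLp.zero_snd, hx]
      simp
    rw [integral_congr_ae h1, integral_congr_ae h2]
    simp
  add_mem' := by
    intro a b ha hb φ hφ i
    have h1 : (fun x => (WithLp.fst (a + b)) x * fderiv ℝ φ x (EuclideanSpace.single i 1))
        =ᵐ[volume.restrict Ω]
        fun x => a.fst x * fderiv ℝ φ x (EuclideanSpace.single i 1)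
          + b.fst x * fderiv ℝ φ x (EuclideanSpace.single i 1) := by
      filter_upwards [Lp.coeFn_add a.fst b.fst] with x hx
      simp only [WithLp.add_fst, hx, Pi.add_apply, add_mul]
    have h2 : (fun x => (WithLp.snd (a + b)) x i * φ x) =ᵐ[volume.restrict Ω]
        fun x => a.snd x i * φ x + b.snd x i * φ x := by
      filter_upwards [Lp.coeFn_add a.snd b.snd] with x hx
      simp only [WithLp.add_snd, hx, Pi.add_apply, PiLp.add_apply, add_mul]
    have i1 : ∀ w : Pair Ω, Integrable
        (fun x => w.fst x * fderiv ℝ φ x (EuclideanSpace.single i 1)) (volume.restrict Ω) :=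
      fun w => (Lp.memLp w.fst).integrable_mul (hφ.memLp_fderiv _)
    have i2 : ∀ w : Pair Ω, Integrable (fun x => w.snd x i * φ x) (volume.restrict Ω) :=
      fun w => (memLp_coord w.snd i).integrable_mul hφ.memLp
    rw [integral_congr_ae h1, integral_congr_ae h2, integral_add (i1 a) (i1 b),
      integral_add (i2 a) (i2 b), ha φ hφ i, hb φ hφ i, neg_add]
  smul_mem' := by
    intro c a ha φ hφ i
    have h1 : (fun x => (WithLp.fst (c • a)) x * fderiv ℝ φ x (EuclideanSpace.single i 1))
        =ᵐ[volume.restrict Ω]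
        fun x => c * (a.fst x * fderiv ℝ φ x (EuclideanSpace.single i 1)) := by
      filter_upwards [Lp.coeFn_smul c a.fst] with x hx
      simp only [WithLp.smul_fst, hx, Pi.smul_apply, smul_eq_mul, mul_assoc]
    have h2 : (fun x => (WithLp.snd (c • a)) x i * φ x) =ᵐ[volume.restrict Ω]
        fun x => c * (a.snd x i * φ x) := by
      filter_upwards [Lp.coeFn_smul c a.snd] with x hx
      simp only [WithLp.smul_snd, hx, Pi.smul_apply, PiLp.smul_apply, smul_eq_mul, mul_assoc]
    rw [integral_congr_ae h1, integral_congr_ae h2, integral_const_mul, integral_const_mul,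
      ha φ hφ i, mul_neg]

/-- The space `H¹₀(Ω)`: the closure, in the `H¹` norm, of the pairs `(φ, ∇φ)` with
`φ` smooth and compactly supported in `Ω`. -/
def H10 (Ω : Set Plane) : Submodule ℝ (Pair Ω) :=
  (Submodule.span ℝ {w : Pair Ω | ∃ φ : Plane → ℝ, IsTestFunction Ω φ ∧
    w.fst =ᵐ[volume.restrict Ω] φ ∧ w.snd =ᵐ[volume.restrict Ω] gradient φ}).topologicalClosure

/-- The function `f` underlying an element `(f, ∇f)` of `H¹(Ω)` or `H¹₀(Ω)`. -/
def toFun {Ω : Set Plane} {V : Submodule ℝ (Pair Ω)} (w : V) : L2 Ω := (w : Pair Ω).fst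

/-- The gradient `∇f` of an element `(f, ∇f)` of `H¹(Ω)` or `H¹₀(Ω)`. -/
def grad {Ω : Set Plane} {V : Submodule ℝ (Pair Ω)} (w : V) : L2vec Ω := (w : Pair Ω).snd

/-- Lebesgue measure on the time interval `(0, T)`. -/
abbrev timeMeasure (T : ℝ) : Measure ℝ := volume.restrict (Ioo 0 T)

/-- `w'` is the distributional time derivative of `w` on `(0, T)`, as a function with values in
the dual `V'`, for the usual embeddings `V ⊆ L²(Ω) ⊆ V'`. -/
def IsWeakTimeDeriv {Ω : Set Plane} {V : Submodule ℝ (Pair Ω)} (T : ℝ)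
    (w : ℝ → V) (w' : ℝ → (V →L[ℝ] ℝ)) : Prop :=
  ∀ φ : ℝ → ℝ, IsTestFunction (Ioo 0 T) φ → ∀ ψ : V,
    ∫ t in Ioo 0 T, deriv φ t * ∫ x in Ω, toFun (w t) x * toFun ψ x
      = -∫ t in Ioo 0 T, φ t * w' t ψ

/-- `w ∈ L²(0,T;V)` has the time derivative `w' ∈ L²(0,T;V')`. For `V = H¹(Ω)` this is the
space `W₁(0,T)`, for `V = H¹₀(Ω)` it is `W₂(0,T)`. -/
structure MemW {Ω : Set Plane} {V : Submodule ℝ (Pair Ω)} (T : ℝ)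
    (w : ℝ → V) (w' : ℝ → (V →L[ℝ] ℝ)) : Prop where
  memLp : MemLp w 2 (timeMeasure T)
  memLp_deriv : MemLp w' 2 (timeMeasure T)
  isWeakTimeDeriv : IsWeakTimeDeriv T w w'

/-- `w(0) = w₀` in the sense of traces in `L²(Ω)`: `w(t) → w₀` in `L²(Ω)` as `t → 0⁺`, up to a
null set of times. As elements of `W₁(0,T)` and `W₂(0,T)` agree a.e. with functions in
`C([0,T];L²(Ω))`, it says that the continuous representative of `w` takes the value `w₀` at `0`. -/
def HasInitialValue {Ω : Set Plane} {V : Submodule ℝ (Pair Ω)} (T : ℝ)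
    (w : ℝ → V) (w₀ : Plane → ℝ) : Prop :=
  ∀ ε : ℝ≥0∞, 0 < ε → ∃ η : ℝ, 0 < η ∧ ∀ᵐ t ∂(timeMeasure T), t < η →
    eLpNorm (fun x => toFun (w t) x - w₀ x) 2 (volume.restrict Ω) < ε

/-- The Gaussian `G_ξ`. -/
def gaussian (ξ : ℝ) (x : Plane) : ℝ :=
  (ξ * Real.sqrt (2 * Real.pi))⁻¹ * Real.exp (-‖x‖ ^ 2 / (2 * ξ ^ 2))

/-- The convolution `G_ξ * f` of the Gaussian with a function `f` on `Ω` (extended by zero). -/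
def gconv (Ω : Set Plane) (ξ : ℝ) (f : Plane → ℝ) (x : Plane) : ℝ :=
  ∫ y in Ω, gaussian ξ (x - y) * f y

/-- The diffusion coefficient `g(u) = 1 / (1 + |G_ξ * u| / k²)`. -/
def diffusivity (Ω : Set Plane) (ξ k : ℝ) (u : Plane → ℝ) (x : Plane) : ℝ :=
  1 / (1 + |gconv Ω ξ u x| / k ^ 2)

/-- Weak solutions `(I, u, v)` on `(0,T) × Ω` of
`I_t = div (g(u) ∇I) - 2 v`, `u_t = h(|∇(G_ξ * I)|²) - u + Δu`, `v_t = Δv - (I₀ - I)`,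
with Neumann conditions for `I`, `u`, the Dirichlet condition for `v`, and
`I(0) = I₀`, `u(0) = G_ξ * |∇I₀|²`, `v(0) = 0`. -/
def IsWeakSolution (Ω : Set Plane) (T ξ k : ℝ) (h : ℝ → ℝ) (I₀ : H1 Ω)
    (I u : ℝ → H1 Ω) (v : ℝ → H10 Ω) : Prop :=
  ∃ (I' u' : ℝ → (H1 Ω →L[ℝ] ℝ)) (v' : ℝ → (H10 Ω →L[ℝ] ℝ)),
    (MemW T I I' ∧ MemW T u u' ∧ MemW T v v') ∧
    (∀ Ψ : ℝ → H1 Ω, MemLp Ψ 2 (timeMeasure T) →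
      (∫ t in Ioo 0 T, I' t (Ψ t))
        + (∫ t in Ioo 0 T, ∫ x in Ω,
            diffusivity Ω ξ k (toFun (u t)) x * inner ℝ (grad (I t) x) (grad (Ψ t) x))
        + 2 * (∫ t in Ioo 0 T, ∫ x in Ω, toFun (v t) x * toFun (Ψ t) x) = 0) ∧
    (∀ Ψ : ℝ → H1 Ω, MemLp Ψ 2 (timeMeasure T) →
      (∫ t in Ioo 0 T, u' t (Ψ t))
        - (∫ t in Ioo 0 T, ∫ x in Ω,
            h (‖gradient (gconv Ω ξ (toFun (I t))) x‖ ^ 2) * toFun (Ψ t) x)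
        + (∫ t in Ioo 0 T, ∫ x in Ω, toFun (u t) x * toFun (Ψ t) x)
        + (∫ t in Ioo 0 T, ∫ x in Ω, inner ℝ (grad (u t) x) (grad (Ψ t) x)) = 0) ∧
    (∀ Φ : ℝ → H10 Ω, MemLp Φ 2 (timeMeasure T) →
      (∫ t in Ioo 0 T, v' t (Φ t))
        + (∫ t in Ioo 0 T, ∫ x in Ω, inner ℝ (grad (v t) x) (grad (Φ t) x))
        + (∫ t in Ioo 0 T, ∫ x in Ω, (toFun I₀ x - toFun (I t) x) * toFun (Φ t) x) = 0) ∧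
    HasInitialValue T I (toFun I₀) ∧
    HasInitialValue T u (gconv Ω ξ fun y => ‖grad I₀ y‖ ^ 2) ∧
    HasInitialValue T v (fun _ => 0)

end CPDE

end

/-!
Uniqueness is an energy argument for the difference `(I, u, v)` of two solutions.

The basic tool is the Lions–Magenes identity `‖w(t)‖² = ‖w(0)‖² + 2 ∫₀ᵗ ⟨w', w⟩` for
`w ∈ L²(0,T;V)` with `w' ∈ L²(0,T;V')`. By the du Bois-Reymond lemma
(`ae_eq_const_of_integral_deriv_smul_eq_zero`) the function `w`, read in `V'`, is a primitive of
`w'`; hence `‖w(t+h)‖² - ‖w(t)‖² = ⟨∫ₜ^{t+h} w', w(t+h) + w(t)⟩`. Dividing by `h` and letting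
`h → 0`, where continuity of translations in `L²` is all that is needed, gives the product rule
`(‖w‖²)' = 2 ⟨w', w⟩` in the sense of distributions (`integral_deriv_mul_sq_norm`), and a second
application of du Bois-Reymond gives the identity (`exists_ae_sq_norm_eq`).

The nonlinearities are tame because convolution with the Gaussian maps `L²(Ω)` boundedly to
Lipschitz functions: uniformly in `x`, `g(u)` is Lipschitz in `u ∈ L²(Ω)` and
`|h(|∇(G_ξ * I₁)|²) - h(|∇(G_ξ * I₂)|²)| ≤ C ‖I₁ - I₂‖ (‖I₁‖ + ‖I₂‖)`. Moreover `g(u₁) ≥ ν > 0`,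
since `u₁` is essentially bounded in `L²(Ω)` by the energy identity. Testing the difference of the
equations with the difference of the solutions, cut off at time `t`, then gives, for
`y = ‖I‖² + ‖u‖² + ‖v‖²` and `d = ν ‖∇I‖² + 2 ‖∇u‖² + 2 ‖∇v‖²`,
`y(t) + ∫₀ᵗ d ≤ ∫₀ᵗ α y` with `α = C₁ ‖∇I₂‖² + C₂ (‖I₁‖ + ‖I₂‖) + 3 ∈ L¹(0,T)`
(`image_balance`, `edge_balance`, `texture_balance`). Gronwall's lemma
(`ae_eq_zero_of_le_integral_mul`) shows that `y` and `d` vanish almost everywhere, so that the two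
solutions have the same values and the same gradients.
-/

/-! ### Functions on a time interval and their weak derivatives -/

namespace CPDE

theorem IsTestFunction.eq_zero_of_notMem {F : Type*} [NormedAddCommGroup F] [NormedSpace ℝ F]
    {U : Set F} {φ : F → ℝ} (hφ : IsTestFunction U φ) {x : F} (hx : x ∉ U) : φ x = 0 :=
  image_eq_zero_of_notMem_tsupport fun h => hx (hφ.support h)

theorem IsTestFunction.contDiff_deriv {U : Set ℝ} {φ : ℝ → ℝ} (hφ : IsTestFunction U φ) :
    ContDiff ℝ ∞ (deriv φ) :=
  (contDiff_infty_iff_deriv.1 hφ.smooth).2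

theorem IsTestFunction.integrable {U : Set ℝ} {φ : ℝ → ℝ} (hφ : IsTestFunction U φ) :
    Integrable φ :=
  hφ.smooth.continuous.integrable_of_hasCompactSupport hφ.compact

theorem IsTestFunction.integrable_smul {U : Set ℝ} {φ : ℝ → ℝ} (hφ : IsTestFunction U φ)
    {E : Type*} [NormedAddCommGroup E] [NormedSpace ℝ E] {f : ℝ → E} {μ : Measure ℝ}
    (hf : Integrable f μ) : Integrable (fun t => φ t • f t) μ := by
  obtain ⟨C, hC⟩ := hφ.compact.exists_bound_of_continuous hφ.smooth.continuous
  exact hf.bdd_smul C hφ.smooth.continuous.aestronglyMeasurable (ae_of_all _ hC)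

theorem IsTestFunction.integrable_deriv_smul {U : Set ℝ} {φ : ℝ → ℝ} (hφ : IsTestFunction U φ)
    {E : Type*} [NormedAddCommGroup E] [NormedSpace ℝ E] {f : ℝ → E} {μ : Measure ℝ}
    (hf : Integrable f μ) : Integrable (fun t => deriv φ t • f t) μ := by
  obtain ⟨C, hC⟩ := hφ.compact.deriv.exists_bound_of_continuous hφ.contDiff_deriv.continuous
  exact hf.bdd_smul C hφ.contDiff_deriv.continuous.aestronglyMeasurable (ae_of_all _ hC)

/-- A compact subset of `(0, T)` stays away from both endpoints. -/
theorem exists_subset_Icc_of_isCompact {T : ℝ} {K : Set ℝ} (hT : 0 < T) (hK : IsCompact K)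
    (hKT : K ⊆ Ioo 0 T) : ∃ a b, 0 < a ∧ a ≤ b ∧ b < T ∧ K ⊆ Icc a b := by
  rcases K.eq_empty_or_nonempty with rfl | hne
  · exact ⟨T / 2, T / 2, by linarith, le_rfl, by linarith, empty_subset _⟩
  · obtain ⟨a, ha, ha'⟩ := hK.exists_isLeast hne
    obtain ⟨b, hb, hb'⟩ := hK.exists_isGreatest hne
    exact ⟨a, b, (hKT ha).1, ha' hb, (hKT hb).2, fun x hx => ⟨ha' hx, hb' hx⟩⟩

/-- A test function of integral zero is the derivative of a test function. -/
theorem IsTestFunction.exists_deriv_eq {T : ℝ} (hT : 0 < T) {ψ : ℝ → ℝ}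
    (hψ : IsTestFunction (Ioo 0 T) ψ) (h0 : ∫ t in Ioo 0 T, ψ t = 0) :
    ∃ Φ, IsTestFunction (Ioo 0 T) Φ ∧ deriv Φ = ψ := by
  obtain ⟨a, b, ha, hab, hb, hK⟩ := exists_subset_Icc_of_isCompact hT hψ.compact hψ.support
  have hc := hψ.smooth.continuous
  have hd : ∀ t, HasDerivAt (fun t => ∫ s in (0 : ℝ)..t, ψ s) (ψ t) t := fun t =>
    intervalIntegral.integral_hasDerivAt_right (hc.intervalIntegrable _ _)
      (hc.stronglyMeasurableAtFilter _ _) hc.continuousAt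
  have hz : ∀ x, x ∉ Icc a b → ψ x = 0 := fun x hx =>
    image_eq_zero_of_notMem_tsupport fun h => hx (hK h)
  have hT0 : ∫ s in (0 : ℝ)..T, ψ s = 0 := by
    rw [intervalIntegral.integral_of_le hT.le, integral_Ioc_eq_integral_Ioo, h0]
  have hsupp : Function.support (fun t => ∫ s in (0 : ℝ)..t, ψ s) ⊆ Icc a b := by
    intro t ht
    by_contra hn
    apply ht
    rw [mem_Icc, not_and_or, not_le, not_le] at hn
    rcases hn with hn | hn
    · refine intervalIntegral.integral_zero_ae (ae_of_all _ fun s hs => hz s fun h => ?_)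
      have := (mem_uIoc.1 hs)
      rcases this with h1 | h1
      · linarith [h1.2, h.1]
      · linarith [h1.2, h.1]
    · change ∫ s in (0 : ℝ)..t, ψ s = 0
      rw [← intervalIntegral.integral_add_adjacent_intervals (b := b)
        (hc.intervalIntegrable _ _) (hc.intervalIntegrable _ _)]
      have e1 : ∀ r, b ≤ r → ∫ s in b..r, ψ s = 0 := fun r hr =>
        intervalIntegral.integral_zero_ae (ae_of_all _ fun s hs => hz s fun h => by
          rw [uIoc_of_le hr] at hs
          linarith [hs.1, h.2])
      have e2 := intervalIntegral.integral_add_adjacent_intervals (a := 0) (b := b) (c := T)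
        (hc.intervalIntegrable _ _) (hc.intervalIntegrable _ _) (μ := volume)
      rw [e1 T hb.le, hT0] at e2
      rw [e1 t hn.le, e2]
  have hts : tsupport (fun t => ∫ s in (0 : ℝ)..t, ψ s) ⊆ Icc a b :=
    closure_minimal hsupp isClosed_Icc
  refine ⟨fun t => ∫ s in (0 : ℝ)..t, ψ s, ⟨?_, ?_, ?_⟩, funext fun t => (hd t).deriv⟩
  · refine contDiff_infty_iff_deriv.2 ⟨fun t => (hd t).differentiableAt, ?_⟩
    rw [show deriv (fun t => ∫ s in (0 : ℝ)..t, ψ s) = ψ from funext fun t => (hd t).deriv]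
    exact hψ.smooth
  · exact isCompact_Icc.of_isClosed_subset (isClosed_tsupport _) hts
  · exact hts.trans fun x hx => ⟨ha.trans_le hx.1, hx.2.trans_lt hb⟩

theorem exists_isTestFunction_integral_eq_one {T : ℝ} (hT : 0 < T) :
    ∃ η, IsTestFunction (Ioo 0 T) η ∧ ∫ t in Ioo 0 T, η t = 1 := by
  let b : ContDiffBump (T / 2 : ℝ) := ⟨T / 8, T / 4, by linarith, by linarith⟩
  have hsub : tsupport (b.normed volume) ⊆ Ioo 0 T := by
    rw [b.tsupport_normed_eq, Real.closedBall_eq_Icc]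
    intro x hx
    have h1 : T / 2 - T / 4 ≤ x := hx.1
    have h2 : x ≤ T / 2 + T / 4 := hx.2
    exact ⟨by linarith, by linarith⟩
  refine ⟨b.normed volume, ⟨b.contDiff_normed, b.hasCompactSupport_normed, hsub⟩, ?_⟩
  rw [setIntegral_eq_integral_of_forall_compl_eq_zero, b.integral_normed]
  exact fun x hx => image_eq_zero_of_notMem_tsupport fun h => hx (hsub h)

/-- The lemma of du Bois-Reymond: a function with zero distributional derivative is constant. -/
theorem ae_eq_const_of_integral_deriv_smul_eq_zero {E : Type*} [NormedAddCommGroup E]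
    [NormedSpace ℝ E] [CompleteSpace E] {T : ℝ} (hT : 0 < T) {f : ℝ → E}
    (hf : Integrable f (timeMeasure T))
    (H : ∀ φ, IsTestFunction (Ioo 0 T) φ → ∫ t in Ioo 0 T, deriv φ t • f t = 0) :
    ∃ c, ∀ᵐ t ∂(timeMeasure T), f t = c := by
  obtain ⟨η, hη, hη1⟩ := exists_isTestFunction_integral_eq_one hT
  refine ⟨∫ t in Ioo 0 T, η t • f t, ?_⟩
  set c := ∫ t in Ioo 0 T, η t • f t
  have key : ∀ᵐ t, t ∈ Ioo 0 T → f t - c = 0 := by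
    refine isOpen_Ioo.ae_eq_zero_of_integral_contDiff_smul_eq_zero ?_ ?_
    · exact (show IntegrableOn (fun t => f t - c) (Ioo 0 T) volume from
        hf.sub (integrable_const c)).locallyIntegrableOn
    intro φ hφ hφc hφs
    have hφt : IsTestFunction (Ioo 0 T) φ := ⟨hφ, hφc, hφs⟩
    -- `φ - (∫ φ) η` has integral zero, so it is the derivative of a test function
    have hψ : IsTestFunction (Ioo 0 T) (fun t => φ t - (∫ t in Ioo 0 T, φ t) * η t) := by
      refine ⟨hφ.sub (contDiff_const.mul hη.smooth), hφc.sub hη.compact.mul_left, ?_⟩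
      refine (tsupport_sub φ _).trans (union_subset hφs ?_)
      exact (closure_mono (Function.support_mul_subset_right _ _)).trans hη.support
    have hψ0 : ∫ t in Ioo 0 T, (φ t - (∫ t in Ioo 0 T, φ t) * η t) = 0 := by
      rw [integral_sub hφt.integrable.restrict (hη.integrable.restrict.const_mul _),
        integral_const_mul, hη1, mul_one, sub_self]
    obtain ⟨Φ, hΦ, hΦψ⟩ := hψ.exists_deriv_eq hT hψ0
    have h1 := H Φ hΦ
    simp only [hΦψ, sub_smul, mul_smul] at h1
    rw [integral_sub (hφt.integrable_smul hf) ((hη.integrable_smul hf).fun_smul _), integral_smul,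
      sub_eq_zero] at h1
    rw [← setIntegral_eq_integral_of_forall_compl_eq_zero (s := Ioo 0 T)
      fun t ht => by rw [hφt.eq_zero_of_notMem ht, zero_smul]]
    simp only [smul_sub]
    rw [integral_sub (hφt.integrable_smul hf) (hφt.integrable_smul (integrable_const c)), h1,
      integral_smul_const, sub_self]
  rw [ae_restrict_iff' measurableSet_Ioo]
  filter_upwards [key] with t ht h using sub_eq_zero.1 (ht h)

/-- Integration by parts against the primitive of an integrable function. -/
theorem integral_deriv_smul_primitive {E : Type*} [NormedAddCommGroup E]
    [NormedSpace ℝ E] [CompleteSpace E] {T : ℝ} {p : ℝ → E}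
    (hp : Integrable p (timeMeasure T)) {φ : ℝ → ℝ} (hφ : IsTestFunction (Ioo 0 T) φ) :
    ∫ t in Ioo 0 T, deriv φ t • ∫ s in (0 : ℝ)..t, p s = -∫ t in Ioo 0 T, φ t • p t := by
  have hd : Integrable (deriv φ) (timeMeasure T) :=
    (hφ.contDiff_deriv.continuous.integrable_of_hasCompactSupport hφ.compact.deriv).restrict
  have hint : Integrable (fun z : ℝ × ℝ => {z : ℝ × ℝ | z.2 < z.1}.indicator
      (fun z => deriv φ z.1 • p z.2) z) ((timeMeasure T).prod (timeMeasure T)) :=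
    (hd.smul_prod hp).indicator (measurableSet_lt measurable_snd measurable_fst)
  have e1 : ∫ t in Ioo 0 T, deriv φ t • ∫ s in (0 : ℝ)..t, p s
      = ∫ t in Ioo 0 T, ∫ s in Ioo 0 T, {z : ℝ × ℝ | z.2 < z.1}.indicator
      (fun z => deriv φ z.1 • p z.2) (t, s) := by
    refine setIntegral_congr_fun measurableSet_Ioo fun t ht => ?_
    have : (fun s => {z : ℝ × ℝ | z.2 < z.1}.indicator (fun z => deriv φ z.1 • p z.2) (t, s))
        = (Iio t).indicator (fun s => deriv φ t • p s) := by
      ext s; simp [indicator]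
    rw [this, setIntegral_indicator measurableSet_Iio, integral_smul,
      intervalIntegral.integral_of_le ht.1.le, integral_Ioc_eq_integral_Ioo]
    congr 3
    ext s
    simp only [mem_Ioo, mem_inter_iff, mem_Iio]
    exact ⟨fun h => ⟨⟨h.1, h.2.trans ht.2⟩, h.2⟩, fun h => ⟨h.1.1, h.2⟩⟩
  rw [e1, integral_integral_swap hint, ← integral_neg]
  refine setIntegral_congr_fun measurableSet_Ioo fun s hs => ?_
  have : (fun t => {z : ℝ × ℝ | z.2 < z.1}.indicator (fun z => deriv φ z.1 • p z.2) (t, s))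
      = (Ioi s).indicator (fun t => deriv φ t • p s) := by
    ext t; simp [indicator]
  rw [this, setIntegral_indicator measurableSet_Ioi, integral_smul_const]
  have h2 : Ioo 0 T ∩ Ioi s = Ioo s T := by
    ext t
    simp only [mem_Ioo, mem_inter_iff, mem_Ioi]
    exact ⟨fun h => ⟨h.2, h.1.2⟩, fun h => ⟨⟨hs.1.trans h.1, h.2⟩, h.1⟩⟩
  rw [h2, ← integral_Ioc_eq_integral_Ioo, ← intervalIntegral.integral_of_le hs.2.le,
    intervalIntegral.integral_deriv_eq_sub
      (fun x _ => (hφ.smooth.differentiable (by simp)).differentiableAt)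
      (hφ.contDiff_deriv.continuous.intervalIntegrable _ _),
    hφ.eq_zero_of_notMem (x := T) (by simp), zero_sub, neg_smul]

theorem continuousOn_primitive_timeMeasure {E : Type*} [NormedAddCommGroup E]
    [NormedSpace ℝ E] {T : ℝ} {p : ℝ → E}
    (hp : Integrable p (timeMeasure T)) :
    ContinuousOn (fun t => ∫ s in (0 : ℝ)..t, p s) (Icc 0 T) := by
  refine (intervalIntegral.continuousOn_primitive (f := p) (a := 0) (b := T) (μ := volume) ?_).congr
    fun t ht => intervalIntegral.integral_of_le ht.1
  exact (integrableOn_Icc_iff_integrableOn_Ioo).2 hp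

theorem integrable_primitive {E : Type*} [NormedAddCommGroup E]
    [NormedSpace ℝ E] {T : ℝ} {p : ℝ → E}
    (hp : Integrable p (timeMeasure T)) :
    Integrable (fun t => ∫ s in (0 : ℝ)..t, p s) (timeMeasure T) :=
  ((continuousOn_primitive_timeMeasure hp).integrableOn_Icc).mono_set Ioo_subset_Icc_self

/-- An integrable function whose distributional derivative is integrable is a.e. equal to a
primitive of this derivative. -/
theorem ae_eq_const_add_primitive {E : Type*} [NormedAddCommGroup E]
    [NormedSpace ℝ E] [CompleteSpace E] {T : ℝ} (hT : 0 < T) {f p : ℝ → E}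
    (hf : Integrable f (timeMeasure T)) (hp : Integrable p (timeMeasure T))
    (H : ∀ φ, IsTestFunction (Ioo 0 T) φ →
      ∫ t in Ioo 0 T, deriv φ t • f t = -∫ t in Ioo 0 T, φ t • p t) :
    ∃ c, ∀ᵐ t ∂(timeMeasure T), f t = c + ∫ s in (0 : ℝ)..t, p s := by
  have hP := integrable_primitive hp
  obtain ⟨c, hc⟩ := ae_eq_const_of_integral_deriv_smul_eq_zero hT (hf.sub hP) fun φ hφ => by
    simp only [Pi.sub_apply, smul_sub]
    rw [integral_sub (hφ.integrable_deriv_smul hf) (hφ.integrable_deriv_smul hP), H φ hφ,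
      integral_deriv_smul_primitive hp hφ, sub_self]
  exact ⟨c, hc.mono fun t ht => by rw [← ht]; simp⟩

/-! ### The product rule for the squared norm -/

theorem _root_.MeasureTheory.MemLp.integrable_norm_mul_norm {α E F : Type*} [MeasurableSpace α]
    [NormedAddCommGroup E] [NormedAddCommGroup F] {μ : Measure α} {a : α → E} {b : α → F}
    (ha : MemLp a 2 μ) (hb : MemLp b 2 μ) : Integrable (fun t => ‖a t‖ * ‖b t‖) μ :=
  ha.norm.integrable_mul hb.norm

theorem integral_norm_mul_norm_le {α E F : Type*} [MeasurableSpace α]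
    [NormedAddCommGroup E] [NormedAddCommGroup F] {μ : Measure α} {a : α → E} {b : α → F}
    (ha : MemLp a 2 μ) (hb : MemLp b 2 μ) :
    ∫ t, ‖a t‖ * ‖b t‖ ∂μ ≤ (eLpNorm a 2 μ).toReal * (eLpNorm b 2 μ).toReal := by
  have h := real_inner_le_norm (ha.norm.toLp _) (hb.norm.toLp _)
  rw [L2.inner_def, Lp.norm_toLp, Lp.norm_toLp, eLpNorm_norm, eLpNorm_norm] at h
  refine le_of_eq_of_le (integral_congr_ae ?_) h
  filter_upwards [ha.norm.coeFn_toLp, hb.norm.coeFn_toLp] with t h1 h2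
  rw [h1, h2]
  simp [mul_comm]

theorem _root_.MeasureTheory.MemLp.integrable_clm_apply {α V : Type*} [MeasurableSpace α]
    [NormedAddCommGroup V] [NormedSpace ℝ V] {μ : Measure α} {p : α → V →L[ℝ] ℝ} {x : α → V}
    (hp : MemLp p 2 μ) (hx : MemLp x 2 μ) : Integrable (fun t => p t (x t)) μ := by
  refine (hp.integrable_norm_mul_norm hx).mono' ?_ (ae_of_all _ fun t => (p t).le_opNorm (x t))
  exact isBoundedBilinearMap_apply.continuous.comp_aestronglyMeasurable (hp.1.prodMk hx.1)

theorem memLp_comp_add_right {E : Type*} [NormedAddCommGroup E] {f : ℝ → E}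
    (hf : MemLp f 2 volume) (s : ℝ) : MemLp (fun t => f (t + s)) 2 volume :=
  hf.comp_measurePreserving (measurePreserving_add_right volume s)

theorem eLpNorm_comp_add_right {E : Type*} [NormedAddCommGroup E] {f : ℝ → E}
    (hf : MemLp f 2 volume) (s : ℝ) : eLpNorm (fun t => f (t + s)) 2 volume = eLpNorm f 2 volume :=
  eLpNorm_comp_measurePreserving hf.1 (measurePreserving_add_right volume s)

/-- Translations are continuous in `L²(ℝ; E)`. -/
theorem tendsto_eLpNorm_translate_sub {E : Type*} [NormedAddCommGroup E] {f : ℝ → E}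
    (hf : MemLp f 2 volume) :
    Tendsto (fun s => (eLpNorm (fun t => f (t + s) - f t) 2 volume).toReal) (𝓝 0) (𝓝 0) := by
  have : Fact ((2 : ℝ≥0∞) ≠ ⊤) := ⟨by simp⟩
  have hc : Continuous fun s : ℝ => DomAddAct.mk s +ᵥ hf.toLp f :=
    DomAddAct.continuous_mk.vadd continuous_const
  have h0 := (hc.dist continuous_const (g := fun _ => hf.toLp f)).tendsto 0
  have e : ∀ s : ℝ, dist (DomAddAct.mk s +ᵥ hf.toLp f) (hf.toLp f)
      = (eLpNorm (fun t => f (t + s) - f t) 2 volume).toReal := by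
    intro s
    rw [DomAddAct.mk_vadd_toLp, dist_edist, Lp.edist_toLp_toLp]
    congr 2
    ext t
    simp [add_comm]
  have e0 : dist (DomAddAct.mk (0 : ℝ) +ᵥ hf.toLp f) (hf.toLp f) = 0 := by
    rw [e]; simp
  rw [e0] at h0
  exact h0.congr e

/-- Difference quotients of an integrable function converge to its distributional derivative. -/
theorem tendsto_integral_mul_slope {φ : ℝ → ℝ} (hφ : ContDiff ℝ ∞ φ)
    (hc : HasCompactSupport φ) {f : ℝ → ℝ} (hf : Integrable f) :
    Tendsto (fun h => ∫ t, φ t * (h⁻¹ * (f (t + h) - f t))) (𝓝[>] 0)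
      (𝓝 (-∫ t, deriv φ t * f t)) := by
  obtain ⟨K, hK⟩ := ContDiff.lipschitzWith_of_hasCompactSupport hc hφ (by simp)
  obtain ⟨C, hC⟩ := hc.exists_bound_of_continuous hφ.continuous
  have hm : ∀ s, Integrable fun t => φ t * f (t + s) := fun s =>
    (hf.comp_add_right s).bdd_mul hφ.continuous.aestronglyMeasurable (ae_of_all _ hC)
  have hm' : ∀ s, Integrable fun t => φ (t - s) * f t := fun s =>
    hf.bdd_mul (hφ.continuous.comp (continuous_sub_right s)).aestronglyMeasurable
      (ae_of_all _ fun t => hC _)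
  -- move the difference quotient from `f` to `φ`
  have e : ∀ h : ℝ, ∫ t, φ t * (h⁻¹ * (f (t + h) - f t))
      = ∫ t, (h⁻¹ * (φ (t - h) - φ t)) * f t := by
    intro h
    have e1 : ∫ t, φ t * f (t + h) = ∫ t, φ (t - h) * f t := by
      rw [← integral_add_right_eq_self (fun t => φ (t - h) * f t) h]
      simp
    have e2 : ∀ t, φ t * (h⁻¹ * (f (t + h) - f t)) = h⁻¹ * (φ t * f (t + h) - φ t * f (t + 0)) := by
      intro t; rw [add_zero]; ring
    have e3 : ∀ t, (h⁻¹ * (φ (t - h) - φ t)) * f t = h⁻¹ * (φ (t - h) * f t - φ (t - 0) * f t) := by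
      intro t; rw [sub_zero]; ring
    simp only [e2, e3, integral_const_mul]
    rw [integral_sub (hm h) (hm 0), integral_sub (hm' h) (hm' 0), e1]
    simp
  simp only [e]
  rw [← integral_neg]
  refine tendsto_integral_filter_of_dominated_convergence (fun t => K * ‖f t‖) ?_ ?_
    (hf.norm.const_mul _) ?_
  · refine Eventually.of_forall fun h => ?_
    have : Continuous fun t => h⁻¹ * (φ (t - h) - φ t) := by
      have := hφ.continuous
      fun_prop
    exact this.aestronglyMeasurable.mul hf.1
  · filter_upwards [self_mem_nhdsWithin] with h hh
    refine ae_of_all _ fun t => ?_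
    rw [norm_mul]
    refine mul_le_mul_of_nonneg_right ?_ (norm_nonneg _)
    have h1 := hK.dist_le_mul (t - h) t
    have hh' : 0 < h := hh
    rw [dist_eq_norm, dist_eq_norm, show t - h - t = -h by ring, norm_neg,
      Real.norm_of_nonneg hh'.le] at h1
    rw [norm_mul, norm_inv, Real.norm_of_nonneg hh'.le, inv_mul_le_iff₀ hh', mul_comm h]
    exact h1
  · refine ae_of_all _ fun t => ?_
    rw [← neg_mul]
    refine Tendsto.mul_const _ ?_
    have hd : HasDerivAt (fun s => φ (t - s)) (-deriv φ t) 0 := by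
      have h1 : HasDerivAt φ (deriv φ t) (t - 0) := by
        rw [sub_zero]; exact ((hφ.differentiable (by simp)) t).hasDerivAt
      have h2 := h1.scomp (0 : ℝ) ((hasDerivAt_id (0 : ℝ)).const_sub t)
      rw [neg_smul, one_smul] at h2
      exact h2
    simpa using hd.tendsto_slope_zero_right

/-- The product rule `d/dt ‖j w‖² = 2 ⟨p, w⟩`, in the sense of distributions, when `j* j w` is
the primitive of `p`. -/
theorem integral_deriv_mul_sq_norm {V H : Type*} [NormedAddCommGroup V] [NormedSpace ℝ V]
    [NormedAddCommGroup H] [InnerProductSpace ℝ H] (j : V →L[ℝ] H) {T : ℝ} (hT : 0 < T)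
    {w : ℝ → V} {p : ℝ → V →L[ℝ] ℝ}
    (hw : MemLp w 2 volume) (hp : MemLp p 2 volume) (hws : StronglyMeasurable w)
    (hps : StronglyMeasurable p) (c : V →L[ℝ] ℝ)
    (hwp : ∀ᵐ t, t ∈ Ioo 0 T → ∀ ψ,
      inner ℝ (j (w t)) (j ψ) = c ψ + (∫ s in (0 : ℝ)..t, p s) ψ)
    {φ : ℝ → ℝ} (hφ : IsTestFunction (Ioo 0 T) φ) :
    ∫ t, deriv φ t * ‖j (w t)‖ ^ 2 = -∫ t, φ t * (2 * p t (w t)) := by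
  obtain ⟨a, b, ha, hab, hb, hK⟩ := exists_subset_Icc_of_isCompact hT hφ.compact hφ.support
  obtain ⟨M, hM⟩ := hφ.compact.exists_bound_of_continuous hφ.smooth.continuous
  have hM0 : 0 ≤ M := (norm_nonneg _).trans (hM 0)
  have hpl : ∀ x y, IntervalIntegrable p volume x y := fun x y =>
    ((hp.locallyIntegrable (by norm_num)).integrableOn_isCompact isCompact_uIcc).intervalIntegrable
  have hf : Integrable fun t => ‖j (w t)‖ ^ 2 := by
    simpa [sq] using (j.comp_memLp' hw).integrable_norm_mul_norm (j.comp_memLp' hw)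
  -- the measurable integrand obtained from the difference quotient of `‖j w‖²`
  set x : ℝ → ℝ → V := fun h t => w (t + h) + w t with hx
  have hxm : ∀ h, MemLp (x h) 2 volume := fun h => (memLp_comp_add_right hw h).add hw
  have hxs : ∀ h, StronglyMeasurable (x h) := fun h =>
    (hws.comp_measurable (measurable_add_const h)).add hws
  have hint : ∀ h r : ℝ, Integrable fun t => φ t * p (t + h * r) (x h t) := fun h r =>
    ((memLp_comp_add_right hp (h * r)).integrable_clm_apply (hxm h)).bdd_mul
      hφ.smooth.continuous.aestronglyMeasurable (ae_of_all _ hM)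
  have hbound : ∀ {q : ℝ → V →L[ℝ] ℝ} {y : ℝ → V}, MemLp q 2 volume → MemLp y 2 volume →
      ∫ t, ‖φ t * q t (y t)‖ ≤ M * ((eLpNorm q 2 volume).toReal * (eLpNorm y 2 volume).toReal) := by
    intro q y hq hy
    refine le_trans ?_ (mul_le_mul_of_nonneg_left (integral_norm_mul_norm_le hq hy) hM0)
    rw [← integral_const_mul]
    refine integral_mono_of_nonneg (ae_of_all _ fun t => norm_nonneg _)
      ((hq.integrable_norm_mul_norm hy).const_mul _) (ae_of_all _ fun t => ?_)
    dsimp only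
    rw [norm_mul]
    exact mul_le_mul (hM t) ((q t).le_opNorm _) (norm_nonneg _) hM0
  have hprod : ∀ h : ℝ, Integrable (fun z : ℝ × ℝ => φ z.2 * p (z.2 + h * z.1) (x h z.2))
      ((volume.restrict (Ioc 0 1)).prod volume) := by
    intro h
    have hsm : StronglyMeasurable fun z : ℝ × ℝ => φ z.2 * p (z.2 + h * z.1) (x h z.2) := by
      refine (hφ.smooth.continuous.stronglyMeasurable.comp_measurable measurable_snd).mul ?_
      refine isBoundedBilinearMap_apply.continuous.comp_stronglyMeasurable
        (StronglyMeasurable.prodMk (hps.comp_measurable ?_)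
          ((hxs h).comp_measurable measurable_snd))
      fun_prop
    rw [integrable_prod_iff hsm.aestronglyMeasurable]
    refine ⟨ae_of_all _ fun r => hint h r, ?_⟩
    refine Integrable.of_bound hsm.norm.integral_prod_right.aestronglyMeasurable
      (M * ((eLpNorm p 2 volume).toReal * (eLpNorm (x h) 2 volume).toReal))
      (ae_of_all _ fun r => ?_)
    rw [Real.norm_of_nonneg (integral_nonneg fun t => norm_nonneg _)]
    refine (hbound (memLp_comp_add_right hp (h * r)) (hxm h)).trans_eq ?_
    rw [eLpNorm_comp_add_right hp]
  -- insert `‖j w(t+h)‖² - ‖j w(t)‖² = ⟨∫ₜ^{t+h} p, x h t⟩`, rescale to `r ∈ (0, 1)`, use Fubini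
  have hQ : ∀ᶠ h in 𝓝[>] (0 : ℝ), ∫ t, φ t * (h⁻¹ * (‖j (w (t + h))‖ ^ 2 - ‖j (w t)‖ ^ 2))
      = ∫ r in Ioc (0 : ℝ) 1, ∫ t, φ t * p (t + h * r) (x h t) := by
    have hs : Ioo 0 (T - b) ∈ 𝓝[>] (0 : ℝ) := Ioo_mem_nhdsGT (by linarith)
    filter_upwards [hs] with h hh
    rw [integral_integral_swap (hprod h)]
    have hwp' := (measurePreserving_add_right volume h).quasiMeasurePreserving.ae hwp
    refine integral_congr_ae ?_
    filter_upwards [hwp, hwp'] with t h1 h2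
    rw [integral_const_mul]
    by_cases ht : t ∈ Icc a b
    · congr 1
      have ht1 : t ∈ Ioo 0 T := ⟨ha.trans_le ht.1, ht.2.trans_lt hb⟩
      have ht2 : t + h ∈ Ioo 0 T := ⟨by linarith [ht1.1, hh.1], by linarith [ht.2, hh.2]⟩
      have e1 : ‖j (w (t + h))‖ ^ 2 - ‖j (w t)‖ ^ 2
          = inner ℝ (j (w (t + h))) (j (x h t)) - inner ℝ (j (w t)) (j (x h t)) := by
        simp only [hx, map_add, inner_add_right, real_inner_self_eq_norm_sq]
        rw [real_inner_comm (j (w t)) (j (w (t + h)))]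
        ring
      have e2 := intervalIntegral.smul_integral_comp_add_mul (fun s => p s (x h t)) h t
        (a := 0) (b := 1)
      have e3 : (∫ s in (0 : ℝ)..(t + h), p s) (x h t) - (∫ s in (0 : ℝ)..t, p s) (x h t)
          = ∫ s in t..(t + h), p s (x h t) := by
        rw [← sub_apply,
          intervalIntegral.integral_interval_sub_left (hpl _ _) (hpl _ _)]
        exact ((ContinuousLinearMap.apply ℝ ℝ (x h t)).intervalIntegral_comp_comm (hpl _ _)).symm
      rw [e1, h1 ht1, h2 ht2, add_sub_add_left_eq_sub, e3, inv_mul_eq_iff_eq_mul₀ hh.1.ne',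
        ← intervalIntegral.integral_of_le zero_le_one, ← smul_eq_mul, e2]
      simp
    · have : φ t = 0 := image_eq_zero_of_notMem_tsupport fun h => ht (hK h)
      simp [this]
  -- continuity of translations in `L²`, uniformly in `r`
  have hlim : Tendsto (fun h => ∫ r in Ioc (0 : ℝ) 1, ∫ t, φ t * p (t + h * r) (x h t))
      (𝓝[>] 0) (𝓝 (∫ t, φ t * (2 * p t (w t)))) := by
    set N := (eLpNorm w 2 volume).toReal
    set N' := (eLpNorm p 2 volume).toReal
    have hN : 0 ≤ N := ENNReal.toReal_nonneg
    have hN' : 0 ≤ N' := ENNReal.toReal_nonneg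
    rw [Metric.tendsto_nhds]
    intro ε hε
    set D := M * (2 * N + N') + 1
    have hD : 0 < D := by positivity
    obtain ⟨δ₁, hδ₁, h₁⟩ := Metric.tendsto_nhds_nhds.1 (tendsto_eLpNorm_translate_sub hp)
      (ε / (2 * D)) (by positivity)
    obtain ⟨δ₂, hδ₂, h₂⟩ := Metric.tendsto_nhds_nhds.1 (tendsto_eLpNorm_translate_sub hw)
      (ε / (2 * D)) (by positivity)
    filter_upwards [Ioo_mem_nhdsGT (lt_min hδ₁ hδ₂)] with h hh
    have key : ∀ r ∈ Ioc (0 : ℝ) 1,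
        ‖(∫ t, φ t * p (t + h * r) (x h t)) - ∫ t, φ t * (2 * p t (w t))‖ ≤ ε / 2 := by
      intro r hr
      have b1 : (eLpNorm (fun t => p (t + h * r) - p t) 2 volume).toReal ≤ ε / (2 * D) := by
        have := h₁ (x := h * r) (by
          rw [dist_zero_right, Real.norm_of_nonneg (mul_nonneg hh.1.le hr.1.le)]
          nlinarith [hh.2, min_le_left δ₁ δ₂, hr.2, hh.1])
        rw [dist_zero_right] at this
        exact (le_abs_self _).trans this.le
      have b2 : (eLpNorm (fun t => w (t + h) - w t) 2 volume).toReal ≤ ε / (2 * D) := by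
        have := h₂ (x := h) (by
          rw [dist_zero_right, Real.norm_of_nonneg hh.1.le]
          linarith [hh.2, min_le_right δ₁ δ₂])
        rw [dist_zero_right] at this
        exact (le_abs_self _).trans this.le
      have m1 : MemLp (fun t => p (t + h * r) - p t) 2 volume :=
        (memLp_comp_add_right hp _).sub hp
      have m2 : MemLp (fun t => w (t + h) - w t) 2 volume := (memLp_comp_add_right hw _).sub hw
      have b3 : (eLpNorm (x h) 2 volume).toReal ≤ 2 * N := by
        have := eLpNorm_add_le (memLp_comp_add_right hw h).1 hw.1 (p := 2) (by norm_num)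
        rw [eLpNorm_comp_add_right hw] at this
        refine (ENNReal.toReal_mono (by simp [hw.2.ne]) this).trans_eq ?_
        rw [ENNReal.toReal_add hw.2.ne hw.2.ne, two_mul]
      have i1 : Integrable fun t => φ t * ((p (t + h * r) - p t) (x h t)) :=
        (m1.integrable_clm_apply (hxm h)).bdd_mul
          hφ.smooth.continuous.aestronglyMeasurable (ae_of_all _ hM)
      have i2 : Integrable fun t => φ t * (p t (w (t + h) - w t)) :=
        (hp.integrable_clm_apply m2).bdd_mul
          hφ.smooth.continuous.aestronglyMeasurable (ae_of_all _ hM)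
      have i3 : Integrable fun t => φ t * (2 * p t (w t)) :=
        ((hp.integrable_clm_apply hw).const_mul 2).bdd_mul
          hφ.smooth.continuous.aestronglyMeasurable (ae_of_all _ hM)
      have e : (∫ t, φ t * p (t + h * r) (x h t)) - ∫ t, φ t * (2 * p t (w t))
          = (∫ t, φ t * ((p (t + h * r) - p t) (x h t)))
            + ∫ t, φ t * (p t (w (t + h) - w t)) := by
        rw [← integral_sub (hint h r) i3, ← integral_add i1 i2]
        congr 1
        ext t
        simp only [hx, sub_apply, map_add, map_sub]
        ring
      rw [e]
      calc _ ≤ M * (ε / (2 * D) * (2 * N)) + M * (N' * (ε / (2 * D))) := by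
            refine (norm_add_le _ _).trans (add_le_add ?_ ?_)
            · refine ((norm_integral_le_integral_norm _).trans (hbound m1 (hxm h))).trans ?_
              gcongr
            · refine ((norm_integral_le_integral_norm _).trans (hbound hp m2)).trans ?_
              gcongr
        _ = (ε / 2) * ((M * (2 * N + N')) / D) := by field_simp
        _ ≤ ε / 2 := by
          refine mul_le_of_le_one_right (by positivity) ?_
          rw [div_le_one hD]
          simp only [D]
          linarith
    have hi : IntegrableOn (fun r => ∫ t, φ t * p (t + h * r) (x h t)) (Ioc 0 1) volume :=
      (hprod h).integral_prod_left
    rw [dist_eq_norm]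
    have e0 : (∫ t, φ t * (2 * p t (w t)))
        = ∫ _ in Ioc (0 : ℝ) 1, ∫ t, φ t * (2 * p t (w t)) := by simp
    rw [e0, ← integral_sub hi (integrable_const _)]
    refine (norm_setIntegral_le_of_norm_le_const (by simp) key).trans_lt ?_
    simp
    linarith
  have h1 := tendsto_integral_mul_slope hφ.smooth hφ.compact hf
  have h2 := tendsto_nhds_unique (h1.congr' hQ) hlim
  linarith

/-! ### Energy identity and Gronwall's lemma on a bounded time interval -/

theorem ae_restrict_Ioc_of_ae_timeMeasure {T : ℝ} {P : ℝ → Prop} (h : ∀ᵐ s ∂(timeMeasure T), P s)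
    {a b : ℝ} (ha : 0 ≤ a) (hb : b ≤ T) : ∀ᵐ s ∂(volume.restrict (Ioc a b)), P s := by
  rw [← restrict_Ioo_eq_restrict_Ioc]
  exact ae_restrict_of_ae_restrict_of_subset (Ioo_subset_Ioo ha hb) h

theorem intervalIntegrable_of_timeMeasure {E : Type*} [NormedAddCommGroup E] {T : ℝ} {p : ℝ → E}
    (hp : Integrable p (timeMeasure T)) {a b : ℝ} (ha : a ∈ Icc 0 T) (hb : b ∈ Icc 0 T) :
    IntervalIntegrable p volume a b := by
  have h1 : IntegrableOn p (Icc 0 T) volume := (integrableOn_Icc_iff_integrableOn_Ioo).2 hp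
  exact (h1.mono_set (uIcc_subset_Icc ha hb)).intervalIntegrable

theorem integral_zero_mono_ae {T : ℝ} {f g : ℝ → ℝ} (hf : Integrable f (timeMeasure T))
    (hg : Integrable g (timeMeasure T)) (hfg : ∀ᵐ t ∂(timeMeasure T), f t ≤ g t)
    {t : ℝ} (ht : t ∈ Icc 0 T) : ∫ s in (0 : ℝ)..t, f s ≤ ∫ s in (0 : ℝ)..t, g s := by
  have h0 : (0 : ℝ) ∈ Icc 0 T := ⟨le_rfl, ht.1.trans ht.2⟩
  refine intervalIntegral.integral_mono_ae_restrict ht.1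
    (intervalIntegrable_of_timeMeasure hf h0 ht) (intervalIntegrable_of_timeMeasure hg h0 ht) ?_
  rw [← restrict_Ioc_eq_restrict_Icc]
  exact ae_restrict_Ioc_of_ae_timeMeasure hfg le_rfl ht.2

/-- A measurable representative of an `L²` function on `(0, T)`, extended by zero to the line. -/
theorem _root_.MeasureTheory.MemLp.exists_extension {E : Type*} [NormedAddCommGroup E] {T : ℝ}
    {f : ℝ → E} (hf : MemLp f 2 (timeMeasure T)) :
    ∃ g : ℝ → E, MemLp g 2 volume ∧ StronglyMeasurable g ∧
      (∀ᵐ t ∂(timeMeasure T), f t = g t) ∧ ∀ t, t ∉ Ioo 0 T → g t = 0 := by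
  refine ⟨(Ioo 0 T).indicator (hf.1.mk f),
    (memLp_indicator_iff_restrict measurableSet_Ioo).2 (hf.ae_eq hf.1.ae_eq_mk),
    hf.1.stronglyMeasurable_mk.indicator measurableSet_Ioo, ?_,
    fun t ht => indicator_of_notMem ht _⟩
  filter_upwards [hf.1.ae_eq_mk, ae_restrict_mem measurableSet_Ioo] with t h1 h2
  rw [h1, indicator_of_mem h2]

section Abstract

variable {V H : Type*} [NormedAddCommGroup V] [NormedSpace ℝ V]
  [NormedAddCommGroup H] [InnerProductSpace ℝ H]

/-- If `p` is the `V'`-valued weak time derivative of `w`, then `j* j w` is a.e. equal to a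
primitive of `p`, with one exceptional null set of times for all `ψ`. -/
theorem exists_ae_inner_eq_primitive (j : V →L[ℝ] H) {T : ℝ} (hT : 0 < T)
    {w : ℝ → V} {p : ℝ → V →L[ℝ] ℝ}
    (hw : MemLp w 2 (timeMeasure T)) (hp : MemLp p 2 (timeMeasure T))
    (hd : ∀ φ : ℝ → ℝ, IsTestFunction (Ioo 0 T) φ → ∀ ψ : V,
      ∫ t in Ioo 0 T, deriv φ t * inner ℝ (j (w t)) (j ψ) = -∫ t in Ioo 0 T, φ t * p t ψ) :
    ∃ c : V →L[ℝ] ℝ, ∀ᵐ t ∂(timeMeasure T), ∀ ψ,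
      inner ℝ (j (w t)) (j ψ) = c ψ + (∫ s in (0 : ℝ)..t, p s) ψ := by
  let B : H →L[ℝ] H →L[ℝ] ℝ := (isBoundedBilinearMap_inner (𝕜 := ℝ) (E := H)).toContinuousLinearMap
  let J : V →L[ℝ] V →L[ℝ] ℝ := ((ContinuousLinearMap.compL ℝ V H ℝ).flip j).comp (B.comp j)
  have hJ : ∀ x ψ, J x ψ = inner ℝ (j x) (j ψ) := fun x ψ => rfl
  have hwi : Integrable (fun t => J (w t)) (timeMeasure T) :=
    J.integrable_comp (hw.integrable (by norm_num))
  have hpi : Integrable p (timeMeasure T) := hp.integrable (by norm_num)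
  obtain ⟨c, hc⟩ := ae_eq_const_add_primitive hT hwi hpi fun φ hφ => by
    ext ψ
    rw [neg_apply, ContinuousLinearMap.integral_apply (hφ.integrable_deriv_smul hwi),
      ContinuousLinearMap.integral_apply (hφ.integrable_smul hpi)]
    simpa [hJ] using hd φ hφ ψ
  exact ⟨c, hc.mono fun t ht ψ => by rw [← hJ, ht, add_apply]⟩

/-- The energy identity of Lions and Magenes, with the value at time `0` left unspecified. -/
theorem exists_ae_sq_norm_eq (j : V →L[ℝ] H) {T : ℝ} (hT : 0 < T)
    {w : ℝ → V} {p : ℝ → V →L[ℝ] ℝ}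
    (hw : MemLp w 2 (timeMeasure T)) (hp : MemLp p 2 (timeMeasure T)) (c : V →L[ℝ] ℝ)
    (hwp : ∀ᵐ t ∂(timeMeasure T), ∀ ψ,
      inner ℝ (j (w t)) (j ψ) = c ψ + (∫ s in (0 : ℝ)..t, p s) ψ) :
    ∃ C : ℝ, ∀ᵐ t ∂(timeMeasure T), ‖j (w t)‖ ^ 2 = C + ∫ s in (0 : ℝ)..t, 2 * p s (w s) := by
  obtain ⟨w₁, hw₁, hws, ew, hw0⟩ := hw.exists_extension
  obtain ⟨p₁, hp₁, hps, ep, hp0⟩ := hp.exists_extension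
  have hwp₁ : ∀ᵐ t, t ∈ Ioo 0 T → ∀ ψ,
      inner ℝ (j (w₁ t)) (j ψ) = c ψ + (∫ s in (0 : ℝ)..t, p₁ s) ψ := by
    rw [← ae_restrict_iff' measurableSet_Ioo]
    filter_upwards [hwp, ew, ae_restrict_mem measurableSet_Ioo] with t h1 h2 h3 ψ
    rw [← h2, h1, intervalIntegral.integral_of_le h3.1.le, intervalIntegral.integral_of_le h3.1.le,
      integral_congr_ae (ae_restrict_Ioc_of_ae_timeMeasure ep le_rfl h3.2.le)]
  have hf : Integrable (fun t => ‖j (w t)‖ ^ 2) (timeMeasure T) := by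
    simpa [sq] using (j.comp_memLp' hw).integrable_norm_mul_norm (j.comp_memLp' hw)
  have hq : Integrable (fun t => 2 * p t (w t)) (timeMeasure T) :=
    (hp.integrable_clm_apply hw).const_mul 2
  refine ae_eq_const_add_primitive hT hf hq fun φ hφ => ?_
  have key := integral_deriv_mul_sq_norm j hT hw₁ hp₁ hws hps c hwp₁ hφ
  rw [← setIntegral_eq_integral_of_forall_compl_eq_zero
      (fun t ht => by rw [hw0 t ht]; simp : ∀ t, t ∉ Ioo 0 T → deriv φ t * ‖j (w₁ t)‖ ^ 2 = 0),
    ← setIntegral_eq_integral_of_forall_compl_eq_zero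
      (fun t ht => by rw [hp0 t ht]; simp : ∀ t, t ∉ Ioo 0 T → φ t * (2 * p₁ t (w₁ t)) = 0)] at key
  simp only [smul_eq_mul]
  refine Eq.trans (integral_congr_ae ?_) (key.trans (congrArg Neg.neg (integral_congr_ae ?_)))
  · filter_upwards [ew] with t h1
    rw [h1]
  · filter_upwards [ew, ep] with t h1 h2
    rw [h1, h2]

/-- The energy identity of Lions and Magenes for zero initial value. -/
theorem ae_sq_norm_eq_of_tendsto_zero (j : V →L[ℝ] H) {T : ℝ} (hT : 0 < T)
    {w : ℝ → V} {p : ℝ → V →L[ℝ] ℝ}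
    (hw : MemLp w 2 (timeMeasure T)) (hp : MemLp p 2 (timeMeasure T)) (c : V →L[ℝ] ℝ)
    (hwp : ∀ᵐ t ∂(timeMeasure T), ∀ ψ,
      inner ℝ (j (w t)) (j ψ) = c ψ + (∫ s in (0 : ℝ)..t, p s) ψ)
    (h0 : ∀ ε > 0, ∃ η > 0, ∀ᵐ t ∂(timeMeasure T), t < η → ‖j (w t)‖ < ε) :
    ∀ᵐ t ∂(timeMeasure T), ‖j (w t)‖ ^ 2 = ∫ s in (0 : ℝ)..t, 2 * p s (w s) := by
  obtain ⟨C, hC⟩ := exists_ae_sq_norm_eq j hT hw hp c hwp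
  have hq : Integrable (fun t => 2 * p t (w t)) (timeMeasure T) :=
    (hp.integrable_clm_apply hw).const_mul 2
  have hcont := continuousOn_primitive_timeMeasure hq
  have hC0 : C = 0 := by
    by_contra hne
    have hpos : 0 < |C| := abs_pos.2 hne
    obtain ⟨η, hη, h1⟩ := h0 (Real.sqrt (|C| / 2)) (by positivity)
    obtain ⟨δ, hδ, h2⟩ := Metric.continuousOn_iff.1 hcont 0 ⟨le_rfl, hT.le⟩ (|C| / 2)
      (by positivity)
    have h3 : ∀ᵐ t ∂(timeMeasure T), ¬ (t < min η δ) := by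
      filter_upwards [hC, h1, ae_restrict_mem measurableSet_Ioo] with t e1 e2 e3 e4
      have e5 := e2 (e4.trans_le (min_le_left _ _))
      have e6 := h2 t (Ioo_subset_Icc_self e3) (by
        rw [dist_zero_right, Real.norm_of_nonneg e3.1.le]
        exact e4.trans_le (min_le_right _ _))
      rw [intervalIntegral.integral_same, dist_zero_right, Real.norm_eq_abs] at e6
      have e7 : ‖j (w t)‖ ^ 2 < |C| / 2 := by
        have := pow_lt_pow_left₀ e5 (norm_nonneg _) two_ne_zero
        rwa [Real.sq_sqrt (by positivity)] at this
      have e8 : |C| ≤ ‖j (w t)‖ ^ 2 + |∫ s in (0 : ℝ)..t, 2 * p s (w s)| := by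
        rw [show C = ‖j (w t)‖ ^ 2 - ∫ s in (0 : ℝ)..t, 2 * p s (w s) by linarith]
        refine (abs_sub _ _).trans_eq ?_
        rw [abs_of_nonneg (sq_nonneg _)]
      linarith
    have hm : 0 < min (min η δ) T := lt_min (lt_min hη hδ) hT
    have h4 : ∀ᵐ t ∂(volume.restrict (Ioo 0 (min (min η δ) T))), False := by
      filter_upwards [ae_restrict_of_ae_restrict_of_subset
        (Ioo_subset_Ioo le_rfl (min_le_right _ _)) h3, ae_restrict_mem measurableSet_Ioo]
        with t e1 e2
      exact e1 (e2.2.trans_le (min_le_left _ _))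
    rw [eventually_false_iff_eq_bot, ae_eq_bot, Measure.restrict_eq_zero, Real.volume_Ioo,
      ENNReal.ofReal_eq_zero] at h4
    linarith
  simpa [hC0] using hC

end Abstract

/-- Gronwall's lemma with an integrable coefficient `α` and a dissipation term `d`, for
inequalities that hold at almost every time. -/
theorem ae_eq_zero_of_le_integral_mul {T : ℝ} (hT : 0 < T) {α y d : ℝ → ℝ}
    (hα : Integrable α (timeMeasure T)) (hα0 : ∀ᵐ t ∂(timeMeasure T), 0 ≤ α t)
    (hy0 : ∀ᵐ t ∂(timeMeasure T), 0 ≤ y t)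
    (hαy : Integrable (fun t => α t * y t) (timeMeasure T))
    (hd : Integrable d (timeMeasure T)) (hd0 : ∀ᵐ t ∂(timeMeasure T), 0 ≤ d t)
    (h : ∀ᵐ t ∂(timeMeasure T),
      y t + ∫ s in (0 : ℝ)..t, d s ≤ ∫ s in (0 : ℝ)..t, α s * y s) :
    (∀ᵐ t ∂(timeMeasure T), y t = 0) ∧ ∀ᵐ t ∂(timeMeasure T), d t = 0 := by
  set Y : ℝ → ℝ := fun t => ∫ s in (0 : ℝ)..t, α s * y s with hYdef
  have h0m : (0 : ℝ) ∈ Icc 0 T := ⟨le_rfl, hT.le⟩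
  have hαy0 : ∀ᵐ t ∂(timeMeasure T), 0 ≤ α t * y t := by
    filter_upwards [hα0, hy0] with t h1 h2 using mul_nonneg h1 h2
  have hYc : ContinuousOn Y (Icc 0 T) := continuousOn_primitive_timeMeasure hαy
  have hAc : ContinuousOn (fun t => ∫ s in (0 : ℝ)..t, α s) (Icc 0 T) :=
    continuousOn_primitive_timeMeasure hα
  have hsub : ∀ x ∈ Icc 0 T, ∀ z ∈ Icc 0 T, Y z - Y x = ∫ s in x..z, α s * y s := fun x hx z hz =>
    intervalIntegral.integral_interval_sub_left (intervalIntegrable_of_timeMeasure hαy h0m hz)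
      (intervalIntegrable_of_timeMeasure hαy h0m hx)
  have hYmono : ∀ x ∈ Icc 0 T, ∀ z ∈ Icc 0 T, x ≤ z → Y x ≤ Y z := by
    intro x hx z hz hxz
    rw [← sub_nonneg, hsub x hx z hz, intervalIntegral.integral_of_le hxz]
    exact integral_nonneg_of_ae (ae_restrict_Ioc_of_ae_timeMeasure hαy0 hx.1 hz.2)
  have hY0 : Y 0 = 0 := intervalIntegral.integral_same
  have hD0 : ∀ t ∈ Icc 0 T, 0 ≤ ∫ s in (0 : ℝ)..t, d s := by
    intro t ht
    rw [intervalIntegral.integral_of_le ht.1]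
    exact integral_nonneg_of_ae (ae_restrict_Ioc_of_ae_timeMeasure hd0 le_rfl ht.2)
  have hyY : ∀ᵐ t ∂(timeMeasure T), y t ≤ Y t := by
    filter_upwards [h, ae_restrict_mem measurableSet_Ioo] with t h1 h2
    linarith [hD0 t (Ioo_subset_Icc_self h2)]
  -- `Y` stays zero: beyond a zero `x`, as long as `∫ α ≤ 1/2`, one has `Y ≤ Y / 2`
  have hYz : Icc 0 T ⊆ {t | Y t = 0} := by
    refine IsClosed.Icc_subset_of_forall_exists_gt ?_ hY0 ?_
    · rw [inter_comm]
      exact hYc.preimage_isClosed_of_isClosed isClosed_Icc isClosed_singleton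
    rintro x ⟨hx0 : Y x = 0, hx⟩ z (hz : x < z)
    have hxI : x ∈ Icc 0 T := Ico_subset_Icc_self hx
    obtain ⟨δ, hδ, h2⟩ := Metric.continuousOn_iff.1 hAc x hxI (1 / 2) (by norm_num)
    have hm : x < min (min z T) (x + δ) := lt_min (lt_min hz hx.2) (by linarith)
    obtain ⟨r, hxr, hr⟩ := exists_between hm
    have hrz : r < z := hr.trans_le ((min_le_left _ _).trans (min_le_left _ _))
    have hrT : r < T := hr.trans_le ((min_le_left _ _).trans (min_le_right _ _))
    have hrδ : r < x + δ := hr.trans_le (min_le_right _ _)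
    have hrI : r ∈ Icc 0 T := ⟨hx.1.trans hxr.le, hrT.le⟩
    have h3 : ∫ s in x..r, α s ≤ 1 / 2 := by
      have h4 := h2 r hrI (by rw [Real.dist_eq, abs_lt]; constructor <;> linarith)
      rw [Real.dist_eq, intervalIntegral.integral_interval_sub_left
        (intervalIntegrable_of_timeMeasure hα h0m hrI)
        (intervalIntegrable_of_timeMeasure hα h0m hxI)] at h4
      exact (le_abs_self _).trans h4.le
    have hYr : 0 ≤ Y r := hx0 ▸ hYmono x hxI r hrI hxr.le
    have h5 : Y r ≤ Y r / 2 := by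
      calc Y r = ∫ s in x..r, α s * y s := by rw [← hsub x hxI r hrI, hx0, sub_zero]
        _ ≤ ∫ s in x..r, α s * Y r := by
          refine intervalIntegral.integral_mono_ae_restrict hxr.le
            (intervalIntegrable_of_timeMeasure hαy hxI hrI)
            ((intervalIntegrable_of_timeMeasure hα hxI hrI).mul_const _) ?_
          rw [← restrict_Ioc_eq_restrict_Icc]
          filter_upwards [ae_restrict_Ioc_of_ae_timeMeasure hyY hx.1 hrT.le,
            ae_restrict_Ioc_of_ae_timeMeasure hα0 hx.1 hrT.le,
            ae_restrict_mem measurableSet_Ioc] with s e1 e2 e3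
          have hs : s ∈ Icc 0 T := ⟨hx.1.trans e3.1.le, e3.2.trans hrT.le⟩
          exact mul_le_mul_of_nonneg_left (e1.trans (hYmono s hs r hrI e3.2)) e2
        _ = (∫ s in x..r, α s) * Y r := intervalIntegral.integral_mul_const _ _
        _ ≤ 1 / 2 * Y r := mul_le_mul_of_nonneg_right h3 hYr
        _ = Y r / 2 := by ring
    exact ⟨r, show Y r = 0 by linarith, hxr, hrz.le⟩
  refine ⟨?_, ?_⟩
  · filter_upwards [hyY, hy0, ae_restrict_mem measurableSet_Ioo] with t h1 h2 h3
    have : Y t = 0 := hYz (Ioo_subset_Icc_self h3)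
    linarith
  · have hD : ∀ᵐ t ∂(timeMeasure T), ∫ s in (0 : ℝ)..t, d s = 0 := by
      filter_upwards [h, hy0, ae_restrict_mem measurableSet_Ioo] with t h1 h2 h3
      have h4 : Y t = 0 := hYz (Ioo_subset_Icc_self h3)
      have h5 := hD0 t (Ioo_subset_Icc_self h3)
      simp only [hYdef] at h4
      linarith
    have hE := Measure.eqOn_Icc_of_ae_eq volume hT.ne
      (by rw [← restrict_Ioo_eq_restrict_Icc]; exact hD)
      (continuousOn_primitive_timeMeasure hd) continuousOn_const (right_mem_Icc.2 hT.le)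
    dsimp only at hE
    rw [intervalIntegral.integral_of_le hT.le, integral_Ioc_eq_integral_Ioo] at hE
    exact (integral_eq_zero_iff_of_nonneg_ae hd0 hd).1 hE

/-! ### Convolution with the Gaussian -/

theorem gaussian_nonneg {ξ : ℝ} (hξ : 0 < ξ) (x : Plane) : 0 ≤ gaussian ξ x := by
  unfold gaussian; positivity

theorem gaussian_le {ξ : ℝ} (hξ : 0 < ξ) (x : Plane) :
    gaussian ξ x ≤ (ξ * Real.sqrt (2 * Real.pi))⁻¹ := by
  unfold gaussian
  refine mul_le_of_le_one_right (by positivity) (Real.exp_le_one_iff.2 ?_)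
  rw [neg_div]
  exact neg_nonpos.2 (by positivity)

theorem hasFDerivAt_gaussian (ξ : ℝ) (x : Plane) :
    HasFDerivAt (gaussian ξ) ((-(ξ ^ 2)⁻¹ * gaussian ξ x) • innerSL ℝ x) x := by
  have h1 : HasFDerivAt (fun y : Plane => -‖y‖ ^ 2 / (2 * ξ ^ 2))
      ((2 * ξ ^ 2)⁻¹ • -((2 : ℕ) • innerSL ℝ x : Plane →L[ℝ] ℝ)) x := by
    have := ((hasStrictFDerivAt_norm_sq x).hasFDerivAt.neg).const_mul (2 * ξ ^ 2)⁻¹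
    refine this.congr_of_eventuallyEq (Eventually.of_forall fun y => ?_)
    simp [div_eq_inv_mul]
  have h2 := (h1.exp).const_mul (ξ * Real.sqrt (2 * Real.pi))⁻¹
  refine h2.congr_fderiv ?_
  ext v
  simp [gaussian]
  ring

theorem lipschitzWith_gaussian {ξ : ℝ} (hξ : 0 < ξ) :
    LipschitzWith (Real.toNNReal ((ξ * Real.sqrt (2 * Real.pi))⁻¹ / ξ)) (gaussian ξ) := by
  refine lipschitzWith_of_nnnorm_fderiv_le
    (fun x => (hasFDerivAt_gaussian ξ x).differentiableAt) fun x => ?_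
  rw [(hasFDerivAt_gaussian ξ x).fderiv, ← NNReal.coe_le_coe, coe_nnnorm,
    Real.coe_toNNReal _ (by positivity), norm_smul, innerSL_apply_norm, norm_mul, norm_neg,
    norm_inv,
    Real.norm_of_nonneg (gaussian_nonneg hξ x), Real.norm_of_nonneg (sq_nonneg ξ)]
  -- `s ≤ ξ exp (s² / (2 ξ²))` because `exp r ≥ 1 + r`
  have h1 : ‖x‖ * Real.exp (-‖x‖ ^ 2 / (2 * ξ ^ 2)) ≤ ξ := by
    rw [neg_div, Real.exp_neg, ← div_eq_mul_inv, div_le_iff₀ (Real.exp_pos _)]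
    have h2 := Real.add_one_le_exp (‖x‖ ^ 2 / (2 * ξ ^ 2))
    refine le_trans ?_ (mul_le_mul_of_nonneg_left h2 hξ.le)
    have h3 : ξ * (‖x‖ ^ 2 / (2 * ξ ^ 2) + 1) - ‖x‖ = ((‖x‖ - ξ) ^ 2 + ξ ^ 2) / (2 * ξ) := by
      field_simp
      ring
    have h4 : 0 ≤ ((‖x‖ - ξ) ^ 2 + ξ ^ 2) / (2 * ξ) := by positivity
    linarith
  calc (ξ ^ 2)⁻¹ * gaussian ξ x * ‖x‖
      = (ξ * Real.sqrt (2 * Real.pi))⁻¹ * (ξ ^ 2)⁻¹ *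
        (‖x‖ * Real.exp (-‖x‖ ^ 2 / (2 * ξ ^ 2))) := by unfold gaussian; ring
    _ ≤ (ξ * Real.sqrt (2 * Real.pi))⁻¹ * (ξ ^ 2)⁻¹ * ξ := by gcongr
    _ = _ := by field_simp

theorem continuous_gaussian {ξ : ℝ} (hξ : 0 < ξ) : Continuous (gaussian ξ) :=
  (lipschitzWith_gaussian hξ).continuous

/-- `|Ω|^(1/2)`, as the `L²(Ω)` norm of the constant `1`; it bounds the embedding
`L²(Ω) ⊆ L¹(Ω)`. -/
noncomputable def sqrtVol (Ω : Set Plane) : ℝ :=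
  (eLpNorm (fun _ : Plane => (1 : ℝ)) 2 (volume.restrict Ω)).toReal

theorem sqrtVol_nonneg (Ω : Set Plane) : 0 ≤ sqrtVol Ω := ENNReal.toReal_nonneg

theorem integrable_gaussian_mul {Ω : Set Plane} {ξ : ℝ} (hξ : 0 < ξ) {f : Plane → ℝ}
    (hf : Integrable f (volume.restrict Ω)) (x : Plane) :
    Integrable (fun y => gaussian ξ (x - y) * f y) (volume.restrict Ω) := by
  refine hf.bdd_mul (c := (ξ * Real.sqrt (2 * Real.pi))⁻¹) ?_ (ae_of_all _ fun y => ?_)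
  · exact ((continuous_gaussian hξ).comp (continuous_const.sub continuous_id)).aestronglyMeasurable
  · rw [Real.norm_of_nonneg (gaussian_nonneg hξ _)]
    exact gaussian_le hξ _

/-- The convolution of the Gaussian with an arbitrary measurable function is measurable. -/
theorem stronglyMeasurable_gconv {Ω : Set Plane} {ξ : ℝ} (hξ : 0 < ξ)
    {f : Plane → ℝ} (hf : StronglyMeasurable f) :
    StronglyMeasurable (gconv Ω ξ f) := by
  have h : StronglyMeasurable fun z : Plane × Plane => gaussian ξ (z.1 - z.2) * f z.2 :=
    ((continuous_gaussian hξ).comp (continuous_fst.sub continuous_snd)).stronglyMeasurable.mul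
      (hf.comp_measurable measurable_snd)
  exact h.integral_prod_right

section

variable {Ω : Set Plane} [IsFiniteMeasure (volume.restrict Ω)] {ξ k : ℝ}

theorem integrable_coe_L2 (f : L2 Ω) : Integrable f (volume.restrict Ω) :=
  (Lp.memLp f).integrable (by norm_num)

theorem integral_abs_le (f : L2 Ω) : ∫ y in Ω, |f y| ≤ sqrtVol Ω * ‖f‖ := by
  have h := integral_norm_mul_norm_le (memLp_const (1 : ℝ) (μ := volume.restrict Ω) (p := 2))
    (Lp.memLp f)
  rw [← Lp.norm_def] at h
  simpa [sqrtVol] using h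

theorem gconv_sub (hξ : 0 < ξ) (f g : L2 Ω) (x : Plane) :
    gconv Ω ξ (f - g : L2 Ω) x = gconv Ω ξ f x - gconv Ω ξ g x := by
  unfold gconv
  rw [← integral_sub (integrable_gaussian_mul hξ (integrable_coe_L2 f) x)
    (integrable_gaussian_mul hξ (integrable_coe_L2 g) x)]
  refine integral_congr_ae ?_
  filter_upwards [Lp.coeFn_sub f g] with y hy
  rw [hy, Pi.sub_apply, mul_sub]

theorem abs_gconv_le (hξ : 0 < ξ) (f : L2 Ω) (x : Plane) :
    |gconv Ω ξ f x| ≤ (ξ * Real.sqrt (2 * Real.pi))⁻¹ * sqrtVol Ω * ‖f‖ := by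
  unfold gconv
  rw [mul_assoc]
  refine (norm_integral_le_integral_norm (fun y => gaussian ξ (x - y) * f y)).trans
    (le_trans ?_ (mul_le_mul_of_nonneg_left (integral_abs_le f) (by positivity)))
  rw [← integral_const_mul]
  refine integral_mono (integrable_gaussian_mul hξ (integrable_coe_L2 f) x).norm
    ((integrable_coe_L2 f).abs.const_mul _) fun y => ?_
  dsimp only
  rw [norm_mul, Real.norm_of_nonneg (gaussian_nonneg hξ _), Real.norm_eq_abs]
  exact mul_le_mul_of_nonneg_right (gaussian_le hξ _) (abs_nonneg _)

theorem lipschitzWith_gconv (hξ : 0 < ξ) (f : L2 Ω) :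
    LipschitzWith (Real.toNNReal ((ξ * Real.sqrt (2 * Real.pi))⁻¹ / ξ * sqrtVol Ω * ‖f‖))
      (gconv Ω ξ f) := by
  refine LipschitzWith.of_dist_le_mul fun x z => ?_
  have hS := sqrtVol_nonneg Ω
  rw [Real.coe_toNNReal _ (by positivity), dist_eq_norm]
  unfold gconv
  rw [← integral_sub (integrable_gaussian_mul hξ (integrable_coe_L2 f) x)
    (integrable_gaussian_mul hξ (integrable_coe_L2 f) z)]
  calc _ ≤ ∫ y in Ω, (ξ * Real.sqrt (2 * Real.pi))⁻¹ / ξ * dist x z * |f y| := by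
        refine norm_integral_le_of_norm_le ((integrable_coe_L2 f).abs.const_mul _)
          (ae_of_all _ fun y => ?_)
        rw [← sub_mul, norm_mul, Real.norm_eq_abs (f y)]
        refine mul_le_mul_of_nonneg_right ?_ (abs_nonneg _)
        have h := (lipschitzWith_gaussian hξ).dist_le_mul (x - y) (z - y)
        rwa [Real.coe_toNNReal _ (by positivity), dist_sub_right, dist_eq_norm] at h
    _ ≤ (ξ * Real.sqrt (2 * Real.pi))⁻¹ / ξ * dist x z * (sqrtVol Ω * ‖f‖) := by
        rw [integral_const_mul]
        exact mul_le_mul_of_nonneg_left (integral_abs_le f) (by positivity)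
    _ = _ := by ring

theorem differentiable_gconv (hξ : 0 < ξ) (f : L2 Ω) : Differentiable ℝ (gconv Ω ξ f) := by
  intro x
  have hF' : ∀ y : Plane, HasFDerivAt (fun x => gaussian ξ (x - y) * f y)
      (f y • ((-(ξ ^ 2)⁻¹ * gaussian ξ (x - y)) • innerSL ℝ (x - y))) x := fun y => by
    have h1 := (hasFDerivAt_gaussian ξ (x - y)).comp x ((hasFDerivAt_id x).sub_const y)
    rw [ContinuousLinearMap.comp_id] at h1
    exact h1.mul_const (f y)
  refine (hasFDerivAt_integral_of_dominated_loc_of_lip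
    (bound := fun y => (ξ * Real.sqrt (2 * Real.pi))⁻¹ / ξ * |f y|)
    (F' := fun y => f y • ((-(ξ ^ 2)⁻¹ * gaussian ξ (x - y)) • innerSL ℝ (x - y)))
    (Metric.ball_mem_nhds x one_pos)
    (Eventually.of_forall fun z => (integrable_gaussian_mul hξ (integrable_coe_L2 f) z).1)
    (integrable_gaussian_mul hξ (integrable_coe_L2 f) x) ?_ (ae_of_all _ fun y => ?_)
    ((integrable_coe_L2 f).abs.const_mul _) (ae_of_all _ hF')).2.differentiableAt
  · refine (Lp.stronglyMeasurable f).aestronglyMeasurable.smul ?_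
    refine Continuous.aestronglyMeasurable ?_
    have := continuous_gaussian hξ
    fun_prop
  · refine LipschitzOnWith.of_dist_le_mul fun u _ v _ => ?_
    rw [Real.coe_nnabs, abs_of_nonneg (by positivity), dist_eq_norm, ← sub_mul, norm_mul,
      Real.norm_eq_abs (f y), mul_right_comm]
    refine mul_le_mul_of_nonneg_right ?_ (abs_nonneg _)
    have h := (lipschitzWith_gaussian hξ).dist_le_mul (u - y) (v - y)
    rwa [Real.coe_toNNReal _ (by positivity), dist_sub_right, dist_eq_norm] at h

theorem norm_gradient_eq (f : Plane → ℝ) (x : Plane) : ‖gradient f x‖ = ‖fderiv ℝ f x‖ := by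
  simp [gradient]

theorem norm_gradient_gconv_le (hξ : 0 < ξ) (f : L2 Ω) (x : Plane) :
    ‖gradient (gconv Ω ξ f) x‖ ≤ (ξ * Real.sqrt (2 * Real.pi))⁻¹ / ξ * sqrtVol Ω * ‖f‖ := by
  have hS := sqrtVol_nonneg Ω
  rw [norm_gradient_eq]
  refine (norm_fderiv_le_of_lipschitz ℝ (lipschitzWith_gconv hξ f)).trans_eq ?_
  rw [Real.coe_toNNReal _ (by positivity)]

theorem gradient_gconv_sub (hξ : 0 < ξ) (f g : L2 Ω) (x : Plane) :
    gradient (gconv Ω ξ (f - g : L2 Ω)) x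
      = gradient (gconv Ω ξ f) x - gradient (gconv Ω ξ g) x := by
  have h : gconv Ω ξ (f - g : L2 Ω) = gconv Ω ξ f - gconv Ω ξ g := funext (gconv_sub hξ f g)
  rw [h]
  unfold gradient
  rw [fderiv_sub (differentiable_gconv hξ f x) (differentiable_gconv hξ g x), map_sub]

end

/-! ### The diffusion and source terms -/

section Weighted

variable {α E : Type*} [MeasurableSpace α] {μ : Measure α} [NormedAddCommGroup E]
  [InnerProductSpace ℝ E] {a : α → ℝ} {c : ℝ}

theorem integrable_mul_inner (ha : AEStronglyMeasurable a μ) (hac : ∀ x, |a x| ≤ c)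
    (F G : Lp E 2 μ) : Integrable (fun x => a x * inner ℝ (F x) (G x)) μ :=
  (L2.integrable_inner (𝕜 := ℝ) F G).bdd_mul ha (ae_of_all _ hac)

theorem abs_integral_mul_inner_le (hac : ∀ x, |a x| ≤ c) (F G : Lp E 2 μ) :
    |∫ x, a x * inner ℝ (F x) (G x) ∂μ| ≤ c * (‖F‖ * ‖G‖) := by
  rcases isEmpty_or_nonempty α with hα | ⟨⟨x₀⟩⟩
  · have : μ = 0 := Measure.eq_zero_of_isEmpty μ
    subst this
    have hF : ‖F‖ = 0 := by rw [Lp.norm_def]; simp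
    simp [hF]
  have hc : 0 ≤ c := (abs_nonneg _).trans (hac x₀)
  rw [Lp.norm_def, Lp.norm_def]
  refine le_trans ?_ (mul_le_mul_of_nonneg_left
    (integral_norm_mul_norm_le (Lp.memLp F) (Lp.memLp G)) hc)
  rw [← integral_const_mul]
  refine norm_integral_le_of_norm_le (f := fun x => a x * inner ℝ (F x) (G x))
    (((Lp.memLp F).integrable_norm_mul_norm (Lp.memLp G)).const_mul c) (ae_of_all _ fun x => ?_)
  rw [norm_mul]
  exact mul_le_mul (hac x) (norm_inner_le_norm _ _) (norm_nonneg _) hc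

theorem integral_mul_inner_sub_left (ha : AEStronglyMeasurable a μ) (hac : ∀ x, |a x| ≤ c)
    (F F' G : Lp E 2 μ) :
    ∫ x, a x * inner ℝ ((F - F' : Lp E 2 μ) x) (G x) ∂μ
      = (∫ x, a x * inner ℝ (F x) (G x) ∂μ) - ∫ x, a x * inner ℝ (F' x) (G x) ∂μ := by
  rw [← integral_sub (integrable_mul_inner ha hac F G) (integrable_mul_inner ha hac F' G)]
  refine integral_congr_ae ?_
  filter_upwards [Lp.coeFn_sub F F'] with x hx
  rw [hx, Pi.sub_apply, inner_sub_left, mul_sub]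

theorem integral_mul_inner_sub_right (ha : AEStronglyMeasurable a μ) (hac : ∀ x, |a x| ≤ c)
    (F G G' : Lp E 2 μ) :
    ∫ x, a x * inner ℝ (F x) ((G - G' : Lp E 2 μ) x) ∂μ
      = (∫ x, a x * inner ℝ (F x) (G x) ∂μ) - ∫ x, a x * inner ℝ (F x) (G' x) ∂μ := by
  have h := integral_mul_inner_sub_left ha hac G G' F
  simp only [real_inner_comm (F _)] at h
  exact h

end Weighted

section

variable {Ω : Set Plane} [IsFiniteMeasure (volume.restrict Ω)] {ξ k : ℝ}

theorem continuous_diffusivity (hξ : 0 < ξ) (u : L2 Ω) : Continuous (diffusivity Ω ξ k u) := by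
  have h := (lipschitzWith_gconv hξ u).continuous
  unfold diffusivity
  refine Continuous.div continuous_const (by fun_prop) fun x => ?_
  positivity

omit [IsFiniteMeasure (volume.restrict Ω)] in
theorem abs_diffusivity_le (u : Plane → ℝ) (x : Plane) : |diffusivity Ω ξ k u x| ≤ 1 := by
  unfold diffusivity
  have h : 0 ≤ |gconv Ω ξ u x| / k ^ 2 := by positivity
  rw [abs_of_nonneg (by positivity), div_le_one (by positivity)]
  linarith

theorem le_diffusivity (hξ : 0 < ξ) (u : L2 Ω) (x : Plane) :
    1 / (1 + (ξ * Real.sqrt (2 * Real.pi))⁻¹ * sqrtVol Ω / k ^ 2 * ‖u‖)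
      ≤ diffusivity Ω ξ k u x := by
  unfold diffusivity
  refine one_div_le_one_div_of_le (by positivity) ?_
  have := div_le_div_of_nonneg_right (abs_gconv_le hξ u x) (sq_nonneg k)
  rw [mul_div_right_comm] at this
  linarith

theorem abs_diffusivity_sub_le (hξ : 0 < ξ) (u v : L2 Ω) (x : Plane) :
    |diffusivity Ω ξ k u x - diffusivity Ω ξ k v x|
      ≤ (ξ * Real.sqrt (2 * Real.pi))⁻¹ * sqrtVol Ω / k ^ 2 * ‖u - v‖ := by
  have h1 := div_le_div_of_nonneg_right (abs_gconv_le hξ (u - v) x) (sq_nonneg k)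
  rw [gconv_sub hξ, mul_div_right_comm] at h1
  refine le_trans ?_ h1
  unfold diffusivity
  set p := gconv Ω ξ u x
  set q := gconv Ω ξ v x
  have hp : 0 ≤ |p| / k ^ 2 := by positivity
  have hq : 0 ≤ |q| / k ^ 2 := by positivity
  have e : 1 / (1 + |p| / k ^ 2) - 1 / (1 + |q| / k ^ 2)
      = ((|q| - |p|) / k ^ 2) / ((1 + |p| / k ^ 2) * (1 + |q| / k ^ 2)) := by
    rw [div_sub_div _ _ (by positivity) (by positivity)]
    congr 1
    ring
  rw [e, abs_div, abs_of_nonneg (a := (1 + |p| / k ^ 2) * (1 + |q| / k ^ 2)) (by positivity)]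
  refine (div_le_self (abs_nonneg _) ?_).trans ?_
  · nlinarith [mul_nonneg hp hq]
  · rw [abs_div, abs_of_nonneg (sq_nonneg k)]
    refine div_le_div_of_nonneg_right ?_ (sq_nonneg k)
    rw [abs_sub_comm]
    exact abs_abs_sub_abs_le _ _

variable (Ω ξ k) in
/-- The form `∫ g(u) F · G` of the diffusion term. -/
noncomputable def diffusionForm (u : L2 Ω) (F G : L2vec Ω) : ℝ :=
  ∫ x in Ω, diffusivity Ω ξ k u x * inner ℝ (F x) (G x)

theorem abs_diffusionForm_sub_le (hξ : 0 < ξ) (u v : L2 Ω) (F G : L2vec Ω) :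
    |diffusionForm Ω ξ k u F G - diffusionForm Ω ξ k v F G|
      ≤ (ξ * Real.sqrt (2 * Real.pi))⁻¹ * sqrtVol Ω / k ^ 2 * ‖u - v‖ * (‖F‖ * ‖G‖) := by
  unfold diffusionForm
  rw [← integral_sub
    (integrable_mul_inner (continuous_diffusivity hξ u).aestronglyMeasurable (abs_diffusivity_le _)
      F G)
    (integrable_mul_inner (continuous_diffusivity hξ v).aestronglyMeasurable (abs_diffusivity_le _)
      F G)]
  simp only [← sub_mul]
  exact abs_integral_mul_inner_le (abs_diffusivity_sub_le hξ u v) F G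

theorem diffusionForm_sub_left (hξ : 0 < ξ) (u : L2 Ω) (F F' G : L2vec Ω) :
    diffusionForm Ω ξ k u (F - F') G
      = diffusionForm Ω ξ k u F G - diffusionForm Ω ξ k u F' G :=
  integral_mul_inner_sub_left (continuous_diffusivity hξ u).aestronglyMeasurable
    (abs_diffusivity_le _) F F' G

theorem diffusionForm_sub_right (hξ : 0 < ξ) (u : L2 Ω) (F G G' : L2vec Ω) :
    diffusionForm Ω ξ k u F (G - G')
      = diffusionForm Ω ξ k u F G - diffusionForm Ω ξ k u F G' :=
  integral_mul_inner_sub_right (continuous_diffusivity hξ u).aestronglyMeasurable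
    (abs_diffusivity_le _) F G G'

omit [IsFiniteMeasure (volume.restrict Ω)] in
theorem abs_diffusionForm_le (u : L2 Ω) (F G : L2vec Ω) :
    |diffusionForm Ω ξ k u F G| ≤ ‖F‖ * ‖G‖ := by
  rw [← one_mul (‖F‖ * ‖G‖)]
  exact abs_integral_mul_inner_le (abs_diffusivity_le u) F G

theorem le_diffusionForm_self (hξ : 0 < ξ) (u : L2 Ω) (F : L2vec Ω) :
    1 / (1 + (ξ * Real.sqrt (2 * Real.pi))⁻¹ * sqrtVol Ω / k ^ 2 * ‖u‖) * ‖F‖ ^ 2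
      ≤ diffusionForm Ω ξ k u F F := by
  rw [← real_inner_self_eq_norm_sq, L2.inner_def, ← integral_const_mul]
  refine integral_mono ((L2.integrable_inner F F).const_mul _)
    (integrable_mul_inner (continuous_diffusivity hξ u).aestronglyMeasurable (abs_diffusivity_le _)
      F F) fun x => ?_
  exact mul_le_mul_of_nonneg_right (le_diffusivity hξ u x) real_inner_self_nonneg

theorem continuous_diffusionForm (hξ : 0 < ξ) :
    Continuous fun z : L2 Ω × L2vec Ω × L2vec Ω => diffusionForm Ω ξ k z.1 z.2.1 z.2.2 := by
  rw [continuous_iff_continuousAt]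
  rintro ⟨u, F, G⟩
  rw [ContinuousAt, tendsto_iff_norm_sub_tendsto_zero]
  set A := (ξ * Real.sqrt (2 * Real.pi))⁻¹ * sqrtVol Ω / k ^ 2
  have hc : Continuous fun z : L2 Ω × L2vec Ω × L2vec Ω =>
      A * ‖z.1 - u‖ * (‖z.2.1‖ * ‖z.2.2‖) + ‖z.2.1 - F‖ * ‖z.2.2‖ + ‖F‖ * ‖z.2.2 - G‖ := by
    fun_prop
  refine squeeze_zero (fun z => norm_nonneg _) (fun z => ?_)
    (by simpa using hc.tendsto (u, F, G))
  have e : diffusionForm Ω ξ k z.1 z.2.1 z.2.2 - diffusionForm Ω ξ k u F G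
      = (diffusionForm Ω ξ k z.1 z.2.1 z.2.2 - diffusionForm Ω ξ k u z.2.1 z.2.2)
        + diffusionForm Ω ξ k u (z.2.1 - F) z.2.2 + diffusionForm Ω ξ k u F (z.2.2 - G) := by
    rw [diffusionForm_sub_left hξ, diffusionForm_sub_right hξ]
    ring
  rw [e]
  refine (norm_add₃_le).trans ?_
  gcongr
  · exact abs_diffusionForm_sub_le hξ _ _ _ _
  · exact abs_diffusionForm_le _ _ _
  · exact abs_diffusionForm_le _ _ _

variable (Ω ξ) in
/-- The form `∫ h(|∇(G_ξ * f)|²) ψ` of the source term. -/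
noncomputable def sourceForm (h : ℝ → ℝ) (f ψ : L2 Ω) : ℝ :=
  ∫ x in Ω, h (‖gradient (gconv Ω ξ f) x‖ ^ 2) * ψ x

omit [IsFiniteMeasure (volume.restrict Ω)] in
theorem measurable_source {h : ℝ → ℝ} {c_h : ℝ≥0} (hLip : LipschitzOnWith c_h h (Ici 0))
    (f : Plane → ℝ) : Measurable fun x => h (‖gradient f x‖ ^ 2) := by
  have h1 : Continuous fun s : ℝ => h (max s 0) :=
    hLip.continuousOn.comp_continuous (by fun_prop) fun s => mem_Ici.2 (le_max_right _ _)
  have h2 : Measurable fun x => ‖fderiv ℝ f x‖ ^ 2 := (measurable_fderiv ℝ f).norm.pow_const 2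
  have h3 : (fun x => h (‖gradient f x‖ ^ 2)) = fun x => h (max (‖fderiv ℝ f x‖ ^ 2) 0) :=
    funext fun x => by rw [norm_gradient_eq, max_eq_left (sq_nonneg _)]
  rw [h3]
  exact h1.measurable.comp h2

theorem abs_source_sub_le (hξ : 0 < ξ) {h : ℝ → ℝ} {c_h : ℝ≥0}
    (hLip : LipschitzOnWith c_h h (Ici 0)) (f g : L2 Ω) (x : Plane) :
    |h (‖gradient (gconv Ω ξ f) x‖ ^ 2) - h (‖gradient (gconv Ω ξ g) x‖ ^ 2)|
      ≤ c_h * ((ξ * Real.sqrt (2 * Real.pi))⁻¹ / ξ * sqrtVol Ω) ^ 2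
        * (‖f - g‖ * (‖f‖ + ‖g‖)) := by
  have hS := sqrtVol_nonneg Ω
  have hB : 0 ≤ (ξ * Real.sqrt (2 * Real.pi))⁻¹ / ξ * sqrtVol Ω := by positivity
  set B := (ξ * Real.sqrt (2 * Real.pi))⁻¹ / ξ * sqrtVol Ω
  have h1 := hLip.dist_le_mul (‖gradient (gconv Ω ξ f) x‖ ^ 2) (mem_Ici.2 (sq_nonneg _))
    (‖gradient (gconv Ω ξ g) x‖ ^ 2) (mem_Ici.2 (sq_nonneg _))
  rw [Real.dist_eq, Real.dist_eq, sq_sub_sq, abs_mul,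
    abs_of_nonneg (add_nonneg (norm_nonneg _) (norm_nonneg _))] at h1
  have h2 : |‖gradient (gconv Ω ξ f) x‖ - ‖gradient (gconv Ω ξ g) x‖| ≤ B * ‖f - g‖ := by
    refine (abs_norm_sub_norm_le _ _).trans ?_
    rw [← gradient_gconv_sub hξ]
    exact norm_gradient_gconv_le hξ _ x
  have h3 : ‖gradient (gconv Ω ξ f) x‖ + ‖gradient (gconv Ω ξ g) x‖ ≤ B * ‖f‖ + B * ‖g‖ :=
    add_le_add (norm_gradient_gconv_le hξ _ x) (norm_gradient_gconv_le hξ _ x)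
  calc _ ≤ (c_h : ℝ) * ((B * ‖f‖ + B * ‖g‖) * (B * ‖f - g‖)) := by
        refine h1.trans (mul_le_mul_of_nonneg_left ?_ c_h.2)
        exact mul_le_mul h3 h2 (abs_nonneg _) (by positivity)
    _ = _ := by ring

theorem abs_integral_mul_le {b : Plane → ℝ} {c : ℝ} (hbc : ∀ x, |b x| ≤ c) (ψ : L2 Ω) :
    |∫ x in Ω, b x * ψ x| ≤ c * (sqrtVol Ω * ‖ψ‖) := by
  have hc : 0 ≤ c := (abs_nonneg _).trans (hbc 0)
  refine le_trans ?_ (mul_le_mul_of_nonneg_left (integral_abs_le ψ) hc)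
  rw [← integral_const_mul]
  refine norm_integral_le_of_norm_le (f := fun x => b x * ψ x)
    ((integrable_coe_L2 ψ).abs.const_mul c) (ae_of_all _ fun x => ?_)
  rw [norm_mul]
  exact mul_le_mul_of_nonneg_right (hbc x) (abs_nonneg _)

theorem integrable_source_mul {h : ℝ → ℝ} {c_h : ℝ≥0} (hLip : LipschitzOnWith c_h h (Ici 0))
    (hbd : ∀ s, 0 ≤ s → |h s| ≤ 1) (f : Plane → ℝ) (ψ : L2 Ω) :
    Integrable (fun x => h (‖gradient f x‖ ^ 2) * ψ x) (volume.restrict Ω) :=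
  (integrable_coe_L2 ψ).bdd_mul (measurable_source hLip f).aestronglyMeasurable
    (ae_of_all _ fun _ => hbd _ (sq_nonneg _))

theorem abs_sourceForm_sub_le (hξ : 0 < ξ) {h : ℝ → ℝ} {c_h : ℝ≥0}
    (hLip : LipschitzOnWith c_h h (Ici 0)) (hbd : ∀ s, 0 ≤ s → |h s| ≤ 1) (f g ψ : L2 Ω) :
    |sourceForm Ω ξ h f ψ - sourceForm Ω ξ h g ψ|
      ≤ c_h * ((ξ * Real.sqrt (2 * Real.pi))⁻¹ / ξ * sqrtVol Ω) ^ 2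
        * (‖f - g‖ * (‖f‖ + ‖g‖)) * (sqrtVol Ω * ‖ψ‖) := by
  unfold sourceForm
  rw [← integral_sub (integrable_source_mul hLip hbd _ ψ) (integrable_source_mul hLip hbd _ ψ)]
  simp only [← sub_mul]
  exact abs_integral_mul_le (abs_source_sub_le hξ hLip f g) ψ

theorem abs_sourceForm_le {h : ℝ → ℝ} (hbd : ∀ s, 0 ≤ s → |h s| ≤ 1) (f ψ : L2 Ω) :
    |sourceForm Ω ξ h f ψ| ≤ sqrtVol Ω * ‖ψ‖ := by
  rw [← one_mul (sqrtVol Ω * ‖ψ‖)]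
  exact abs_integral_mul_le (fun x => hbd _ (sq_nonneg _)) ψ

theorem sourceForm_sub_right {h : ℝ → ℝ} {c_h : ℝ≥0} (hLip : LipschitzOnWith c_h h (Ici 0))
    (hbd : ∀ s, 0 ≤ s → |h s| ≤ 1) (f ψ χ : L2 Ω) :
    sourceForm Ω ξ h f (ψ - χ) = sourceForm Ω ξ h f ψ - sourceForm Ω ξ h f χ := by
  unfold sourceForm
  rw [← integral_sub (integrable_source_mul hLip hbd _ ψ) (integrable_source_mul hLip hbd _ χ)]
  refine integral_congr_ae ?_
  filter_upwards [Lp.coeFn_sub ψ χ] with x hx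
  rw [hx, Pi.sub_apply, mul_sub]

theorem continuous_sourceForm (hξ : 0 < ξ) {h : ℝ → ℝ} {c_h : ℝ≥0}
    (hLip : LipschitzOnWith c_h h (Ici 0)) (hbd : ∀ s, 0 ≤ s → |h s| ≤ 1) :
    Continuous fun z : L2 Ω × L2 Ω => sourceForm Ω ξ h z.1 z.2 := by
  rw [continuous_iff_continuousAt]
  rintro ⟨f, ψ⟩
  rw [ContinuousAt, tendsto_iff_norm_sub_tendsto_zero]
  set A := (c_h : ℝ) * ((ξ * Real.sqrt (2 * Real.pi))⁻¹ / ξ * sqrtVol Ω) ^ 2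
  have hc : Continuous fun z : L2 Ω × L2 Ω =>
      A * (‖z.1 - f‖ * (‖z.1‖ + ‖f‖)) * (sqrtVol Ω * ‖z.2‖) + sqrtVol Ω * ‖z.2 - ψ‖ := by
    fun_prop
  refine squeeze_zero (fun z => norm_nonneg _) (fun z => ?_)
    (by simpa using hc.tendsto (f, ψ))
  have e : sourceForm Ω ξ h z.1 z.2 - sourceForm Ω ξ h f ψ
      = (sourceForm Ω ξ h z.1 z.2 - sourceForm Ω ξ h f z.2)
        + sourceForm Ω ξ h f (z.2 - ψ) := by
    rw [sourceForm_sub_right hLip hbd]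
    ring
  rw [e]
  refine (norm_add_le _ _).trans ?_
  gcongr
  · exact abs_sourceForm_sub_le hξ hLip hbd _ _ _
  · exact abs_sourceForm_le hbd _ _

end

/-! ### Energy identities in the Sobolev spaces -/

/-- Testing with a function cut off at time `t` localizes an integral over `(0, T)` to `(0, t)`. -/
theorem integral_indicator_Ioo {V : Type*} [Zero V] {T : ℝ} {F : ℝ → V → ℝ} (hF : ∀ s, F s 0 = 0)
    (z : ℝ → V) {t : ℝ} (ht : t ∈ Ioo 0 T) :
    ∫ s in Ioo 0 T, F s ((Ioo 0 t).indicator z s) = ∫ s in (0 : ℝ)..t, F s (z s) := by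
  have e : ∀ s, F s ((Ioo 0 t).indicator z s) = (Ioo 0 t).indicator (fun s => F s (z s)) s := by
    intro s
    by_cases hs : s ∈ Ioo 0 t
    · rw [indicator_of_mem hs, indicator_of_mem hs]
    · rw [indicator_of_notMem hs, indicator_of_notMem hs, hF]
  simp only [e]
  rw [setIntegral_indicator measurableSet_Ioo, Ioo_inter_Ioo, max_self, min_eq_right ht.2.le,
    intervalIntegral.integral_of_le ht.1.le, integral_Ioc_eq_integral_Ioo]

/-- The energy identity for two functions whose difference vanishes at time `0` and whose
time derivatives are given, as functionals on `L²(0,T;V)`, by `R₁` and `R₂`. -/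
theorem ae_sq_norm_sub_eq {V H : Type*} [NormedAddCommGroup V] [NormedSpace ℝ V]
    [NormedAddCommGroup H] [InnerProductSpace ℝ H] (j : V →L[ℝ] H) {T : ℝ} (hT : 0 < T)
    {w₁ w₂ : ℝ → V} {w₁' w₂' : ℝ → V →L[ℝ] ℝ}
    (hw₁ : MemLp w₁ 2 (timeMeasure T)) (hw₂ : MemLp w₂ 2 (timeMeasure T))
    (hw₁' : MemLp w₁' 2 (timeMeasure T)) (hw₂' : MemLp w₂' 2 (timeMeasure T))
    {c₁ c₂ : V →L[ℝ] ℝ}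
    (hc₁ : ∀ᵐ t ∂(timeMeasure T), ∀ ψ,
      inner ℝ (j (w₁ t)) (j ψ) = c₁ ψ + (∫ s in (0 : ℝ)..t, w₁' s) ψ)
    (hc₂ : ∀ᵐ t ∂(timeMeasure T), ∀ ψ,
      inner ℝ (j (w₂ t)) (j ψ) = c₂ ψ + (∫ s in (0 : ℝ)..t, w₂' s) ψ)
    (h0 : ∀ ε > 0, ∃ η > 0, ∀ᵐ t ∂(timeMeasure T), t < η → ‖j (w₁ t - w₂ t)‖ < ε)
    {R₁ R₂ : ℝ → V → ℝ}
    (hR₁ : ∀ s, R₁ s 0 = 0) (hR₂ : ∀ s, R₂ s 0 = 0)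
    (hRi₁ : Integrable (fun s => R₁ s (w₁ s - w₂ s)) (timeMeasure T))
    (hRi₂ : Integrable (fun s => R₂ s (w₁ s - w₂ s)) (timeMeasure T))
    (he₁ : ∀ Ψ : ℝ → V, MemLp Ψ 2 (timeMeasure T) →
      ∫ t in Ioo 0 T, w₁' t (Ψ t) = ∫ t in Ioo 0 T, R₁ t (Ψ t))
    (he₂ : ∀ Ψ : ℝ → V, MemLp Ψ 2 (timeMeasure T) →
      ∫ t in Ioo 0 T, w₂' t (Ψ t) = ∫ t in Ioo 0 T, R₂ t (Ψ t)) :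
    ∀ᵐ t ∂(timeMeasure T), ‖j (w₁ t - w₂ t)‖ ^ 2
      = ∫ s in (0 : ℝ)..t, 2 * (R₁ s (w₁ s - w₂ s) - R₂ s (w₁ s - w₂ s)) := by
  have hz : MemLp (fun s => w₁ s - w₂ s) 2 (timeMeasure T) := hw₁.sub hw₂
  have hp : MemLp (fun s => w₁' s - w₂' s) 2 (timeMeasure T) :=
    hw₁'.sub hw₂'
  have h0m : (0 : ℝ) ∈ Icc 0 T := ⟨le_rfl, hT.le⟩
  have hprim : ∀ᵐ t ∂(timeMeasure T), ∀ ψ,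
      inner ℝ (j (w₁ t - w₂ t)) (j ψ)
        = (c₁ - c₂) ψ + (∫ s in (0 : ℝ)..t, (w₁' s - w₂' s)) ψ := by
    filter_upwards [hc₁, hc₂, ae_restrict_mem measurableSet_Ioo] with t h1 h2 h3 ψ
    rw [map_sub, inner_sub_left, h1, h2, intervalIntegral.integral_sub
      (intervalIntegrable_of_timeMeasure (hw₁'.integrable (by norm_num)) h0m
        (Ioo_subset_Icc_self h3))
      (intervalIntegrable_of_timeMeasure (hw₂'.integrable (by norm_num)) h0m
        (Ioo_subset_Icc_self h3)), sub_apply, sub_apply]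
    ring
  filter_upwards [ae_sq_norm_eq_of_tendsto_zero j hT hz hp (c₁ - c₂) hprim
    h0, ae_restrict_mem measurableSet_Ioo] with t h1 h2
  have hΨ : MemLp ((Ioo 0 t).indicator fun s => w₁ s - w₂ s) 2 (timeMeasure T) :=
    hz.indicator measurableSet_Ioo
  have k₁ := he₁ _ hΨ
  have k₂ := he₂ _ hΨ
  rw [integral_indicator_Ioo (F := fun s ψ => w₁' s ψ) (fun s => map_zero _) _ h2,
    integral_indicator_Ioo hR₁ _ h2] at k₁
  rw [integral_indicator_Ioo (F := fun s ψ => w₂' s ψ) (fun s => map_zero _) _ h2,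
    integral_indicator_Ioo hR₂ _ h2] at k₂
  have ht := Ioo_subset_Icc_self h2
  have hji : ∀ {f : ℝ → ℝ}, Integrable f (timeMeasure T) → IntervalIntegrable f volume 0 t :=
    fun hf => intervalIntegrable_of_timeMeasure hf h0m ht
  rw [h1, intervalIntegral.integral_const_mul, intervalIntegral.integral_const_mul,
    intervalIntegral.integral_sub (hji hRi₁) (hji hRi₂), ← k₁, ← k₂, ← intervalIntegral.integral_sub
      (hji (hw₁'.integrable_clm_apply hz)) (hji (hw₂'.integrable_clm_apply hz))]
  simp only [sub_apply]

section

variable {Ω : Set Plane} {V : Submodule ℝ (Pair Ω)} {T : ℝ}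

variable (V) in
/-- The embedding `V ⊆ L²(Ω)` as a continuous linear map. -/
noncomputable def toFunL : V →L[ℝ] L2 Ω := (WithLp.fstL 2 ℝ (L2 Ω) (L2vec Ω)).comp V.subtypeL

variable (V) in
/-- The gradient `V → L²(Ω; ℝ²)` as a continuous linear map. -/
noncomputable def gradL : V →L[ℝ] L2vec Ω := (WithLp.sndL 2 ℝ (L2 Ω) (L2vec Ω)).comp V.subtypeL

theorem toFunL_apply (w : V) : toFunL V w = toFun w := rfl

theorem eq_of_norm_sub_eq_zero {w z : V} (h1 : ‖toFunL V (w - z)‖ ^ 2 = 0)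
    (h2 : ‖gradL V (w - z)‖ ^ 2 = 0) : w = z := by
  rw [sq_eq_zero_iff, norm_eq_zero, map_sub, sub_eq_zero] at h1 h2
  exact Subtype.ext ((WithLp.equiv 2 _).injective (Prod.ext h1 h2))

theorem L2_inner_eq (f g : L2 Ω) : inner ℝ f g = ∫ x in Ω, f x * g x := by
  rw [L2.inner_def]
  simp [mul_comm]

theorem MemW.exists_ae_inner_eq (hT : 0 < T) {w : ℝ → V} {w' : ℝ → V →L[ℝ] ℝ}
    (hw : MemW T w w') : ∃ c : V →L[ℝ] ℝ, ∀ᵐ t ∂(timeMeasure T), ∀ ψ,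
      inner ℝ (toFunL V (w t)) (toFunL V ψ) = c ψ + (∫ s in (0 : ℝ)..t, w' s) ψ := by
  refine exists_ae_inner_eq_primitive (toFunL V) hT hw.memLp hw.memLp_deriv fun φ hφ ψ => ?_
  simp only [L2_inner_eq]
  exact hw.isWeakTimeDeriv φ hφ ψ

/-- Functions in `W(0,T)` are essentially bounded with values in `L²(Ω)`. -/
theorem MemW.exists_ae_norm_le (hT : 0 < T) {w : ℝ → V} {w' : ℝ → V →L[ℝ] ℝ}
    (hw : MemW T w w') : ∃ M : ℝ, 0 ≤ M ∧ ∀ᵐ t ∂(timeMeasure T), ‖toFunL V (w t)‖ ≤ M := by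
  obtain ⟨c, hc⟩ := hw.exists_ae_inner_eq hT
  obtain ⟨C, hC⟩ := exists_ae_sq_norm_eq (toFunL V) hT hw.memLp hw.memLp_deriv c hc
  obtain ⟨K, hK⟩ := isCompact_Icc.exists_bound_of_continuousOn (continuousOn_primitive_timeMeasure
    ((hw.memLp_deriv.integrable_clm_apply hw.memLp).const_mul 2))
  refine ⟨Real.sqrt (C + K), Real.sqrt_nonneg _, ?_⟩
  filter_upwards [hC, ae_restrict_mem measurableSet_Ioo] with t h1 h2
  refine Real.le_sqrt_of_sq_le ?_
  rw [h1]
  gcongr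
  exact (le_abs_self _).trans (hK t (Ioo_subset_Icc_self h2))

/-- Two functions with the same initial value have a difference which vanishes at time `0`. -/
theorem HasInitialValue.norm_sub_lt {w₁ w₂ : ℝ → V} {w₀ : Plane → ℝ}
    (hw₀ : StronglyMeasurable w₀) (h₁ : HasInitialValue T w₁ w₀) (h₂ : HasInitialValue T w₂ w₀) :
    ∀ ε > 0, ∃ η > 0, ∀ᵐ t ∂(timeMeasure T), t < η → ‖toFunL V (w₁ t - w₂ t)‖ < ε := by
  intro ε hε
  obtain ⟨η₁, hη₁, e₁⟩ := h₁ (ENNReal.ofReal (ε / 2)) (by simpa using hε)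
  obtain ⟨η₂, hη₂, e₂⟩ := h₂ (ENNReal.ofReal (ε / 2)) (by simpa using hε)
  refine ⟨min η₁ η₂, lt_min hη₁ hη₂, ?_⟩
  filter_upwards [e₁, e₂] with t k₁ k₂ ht
  have a₁ := k₁ (ht.trans_le (min_le_left _ _))
  have a₂ := k₂ (ht.trans_le (min_le_right _ _))
  have hm : ∀ w : V, AEStronglyMeasurable (fun x => toFun w x - w₀ x) (volume.restrict Ω) :=
    fun w => ((Lp.stronglyMeasurable _).sub hw₀).aestronglyMeasurable
  have e : eLpNorm (toFunL V (w₁ t - w₂ t)) 2 (volume.restrict Ω)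
      = eLpNorm ((fun x => toFun (w₁ t) x - w₀ x) - fun x => toFun (w₂ t) x - w₀ x) 2
        (volume.restrict Ω) := by
    refine eLpNorm_congr_ae ?_
    rw [map_sub]
    filter_upwards [Lp.coeFn_sub (toFunL V (w₁ t)) (toFunL V (w₂ t))] with x hx
    rw [hx, Pi.sub_apply, Pi.sub_apply, toFunL_apply, toFunL_apply]
    ring
  have hlt : eLpNorm (toFunL V (w₁ t - w₂ t)) 2 (volume.restrict Ω) < ENNReal.ofReal ε := by
    rw [e]
    refine (eLpNorm_sub_le (hm _) (hm _) (by norm_num)).trans_lt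
      ((ENNReal.add_lt_add a₁ a₂).trans_eq ?_)
    rw [← ENNReal.ofReal_add (by positivity) (by positivity), add_halves]
  rw [Lp.norm_def]
  exact (ENNReal.toReal_lt_toReal (Lp.eLpNorm_ne_top _) ENNReal.ofReal_ne_top).2 hlt |>.trans_eq
    (ENNReal.toReal_ofReal hε.le)

theorem ae_sq_norm_toFunL_sub_eq (hT : 0 < T) {w₁ w₂ : ℝ → V} {w₁' w₂' : ℝ → V →L[ℝ] ℝ}
    {w₀ : Plane → ℝ} (hm₁ : MemW T w₁ w₁') (hm₂ : MemW T w₂ w₂') (hw₀ : StronglyMeasurable w₀)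
    (hi₁ : HasInitialValue T w₁ w₀) (hi₂ : HasInitialValue T w₂ w₀) {R₁ R₂ : ℝ → V → ℝ}
    (hR₁ : ∀ s, R₁ s 0 = 0) (hR₂ : ∀ s, R₂ s 0 = 0)
    (hRi₁ : Integrable (fun s => R₁ s (w₁ s - w₂ s)) (timeMeasure T))
    (hRi₂ : Integrable (fun s => R₂ s (w₁ s - w₂ s)) (timeMeasure T))
    (he₁ : ∀ Ψ : ℝ → V, MemLp Ψ 2 (timeMeasure T) →
      ∫ t in Ioo 0 T, w₁' t (Ψ t) = ∫ t in Ioo 0 T, R₁ t (Ψ t))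
    (he₂ : ∀ Ψ : ℝ → V, MemLp Ψ 2 (timeMeasure T) →
      ∫ t in Ioo 0 T, w₂' t (Ψ t) = ∫ t in Ioo 0 T, R₂ t (Ψ t)) :
    ∀ᵐ t ∂(timeMeasure T), ‖toFunL V (w₁ t - w₂ t)‖ ^ 2
      = ∫ s in (0 : ℝ)..t, 2 * (R₁ s (w₁ s - w₂ s) - R₂ s (w₁ s - w₂ s)) := by
  obtain ⟨c₁, hc₁⟩ := hm₁.exists_ae_inner_eq hT
  obtain ⟨c₂, hc₂⟩ := hm₂.exists_ae_inner_eq hT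
  exact ae_sq_norm_sub_eq (toFunL V) hT hm₁.memLp hm₂.memLp hm₁.memLp_deriv hm₂.memLp_deriv hc₁ hc₂
    (HasInitialValue.norm_sub_lt hw₀ hi₁ hi₂) hR₁ hR₂ hRi₁ hRi₂ he₁ he₂

end

section

variable {Ω : Set Plane} [IsFiniteMeasure (volume.restrict Ω)] {ξ k T : ℝ}

theorem _root_.MeasureTheory.MemLp.integrable_inner {α H : Type*} [MeasurableSpace α]
    {μ : Measure α} [NormedAddCommGroup H] [InnerProductSpace ℝ H] {f g : α → H}
    (hf : MemLp f 2 μ) (hg : MemLp g 2 μ) : Integrable (fun t => inner ℝ (f t) (g t)) μ :=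
  (hf.integrable_norm_mul_norm hg).mono' (hf.1.inner hg.1)
    (ae_of_all _ fun _ => norm_inner_le_norm _ _)

end

/-! ### Integrability and coercivity of the nonlinear terms -/

section

variable {Ω : Set Plane} [IsFiniteMeasure (volume.restrict Ω)] {ξ k T : ℝ}

theorem integrable_diffusionForm (hξ : 0 < ξ) {u : ℝ → L2 Ω} {F G : ℝ → L2vec Ω}
    (hu : MemLp u 2 (timeMeasure T)) (hF : MemLp F 2 (timeMeasure T))
    (hG : MemLp G 2 (timeMeasure T)) :
    Integrable (fun t => diffusionForm Ω ξ k (u t) (F t) (G t)) (timeMeasure T) := by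
  have hm : AEStronglyMeasurable (fun t => (u t, F t, G t)) (timeMeasure T) :=
    hu.1.prodMk (hF.1.prodMk hG.1)
  have hc := (continuous_diffusionForm (Ω := Ω) (k := k) hξ).comp_aestronglyMeasurable hm
  have hi := hF.integrable_norm_mul_norm hG
  exact hi.mono' hc (Eventually.of_forall fun t => abs_diffusionForm_le (u t) (F t) (G t))

theorem integrable_sourceForm (hξ : 0 < ξ) {h : ℝ → ℝ} {c_h : ℝ≥0}
    (hLip : LipschitzOnWith c_h h (Ici 0)) (hbd : ∀ s, 0 ≤ s → |h s| ≤ 1) {f ψ : ℝ → L2 Ω}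
    (hf : MemLp f 2 (timeMeasure T)) (hψ : MemLp ψ 2 (timeMeasure T)) :
    Integrable (fun t => sourceForm Ω ξ h (f t) (ψ t)) (timeMeasure T) := by
  have hm : AEStronglyMeasurable (fun t => (f t, ψ t)) (timeMeasure T) := hf.1.prodMk hψ.1
  have hc := (continuous_sourceForm (Ω := Ω) hξ hLip hbd).comp_aestronglyMeasurable hm
  have hi := (hψ.integrable (by norm_num)).norm.const_mul (sqrtVol Ω)
  exact hi.mono' hc (Eventually.of_forall fun t => abs_sourceForm_le hbd (f t) (ψ t))

omit [IsFiniteMeasure (volume.restrict Ω)] in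
theorem diffusionForm_zero_right (u : L2 Ω) (F : L2vec Ω) : diffusionForm Ω ξ k u F 0 = 0 := by
  have := abs_diffusionForm_le (ξ := ξ) (k := k) u F 0
  simpa using this

theorem sourceForm_zero_right {h : ℝ → ℝ} (hbd : ∀ s, 0 ≤ s → |h s| ≤ 1) (f : L2 Ω) :
    sourceForm Ω ξ h f 0 = 0 := by
  have := abs_sourceForm_le (ξ := ξ) hbd f 0
  simpa using this

/-- Coercivity of the diffusion term, up to the dependence of the coefficient on `u`. -/
theorem diffusionForm_difference_le (hξ : 0 < ξ) {u₁ u₂ : L2 Ω} (F₁ F₂ : L2vec Ω) {M A : ℝ}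
    (hM : ‖u₁‖ ≤ M) (hA : A = (ξ * Real.sqrt (2 * Real.pi))⁻¹ * sqrtVol Ω / k ^ 2) :
    -2 * (diffusionForm Ω ξ k u₁ F₁ (F₁ - F₂) - diffusionForm Ω ξ k u₂ F₂ (F₁ - F₂))
      ≤ -(1 / (1 + A * M)) * ‖F₁ - F₂‖ ^ 2 + A ^ 2 * (1 + A * M) * ‖F₂‖ ^ 2 * ‖u₁ - u₂‖ ^ 2 := by
  have hA0 : 0 ≤ A := by
    have := sqrtVol_nonneg Ω
    rw [hA]
    positivity
  have hM0 : 0 ≤ M := (norm_nonneg _).trans hM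
  have h1 := le_diffusionForm_self (k := k) hξ u₁ (F₁ - F₂)
  have h2 := (abs_le.1 (abs_diffusionForm_sub_le (k := k) hξ u₁ u₂ F₂ (F₁ - F₂))).1
  rw [← hA] at h1 h2
  have h3 : 1 / (1 + A * M) * ‖F₁ - F₂‖ ^ 2 ≤ diffusionForm Ω ξ k u₁ (F₁ - F₂) (F₁ - F₂) := by
    refine le_trans (mul_le_mul_of_nonneg_right ?_ (sq_nonneg _)) h1
    refine one_div_le_one_div_of_le (by positivity) ?_
    gcongr
  rw [diffusionForm_sub_left hξ] at h3
  -- Young's inequality `2 a b ≤ ν a² + b² / ν` with `ν = 1 / (1 + A M)`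
  have h4 : 2 * (A * ‖u₁ - u₂‖ * (‖F₂‖ * ‖F₁ - F₂‖))
      ≤ 1 / (1 + A * M) * ‖F₁ - F₂‖ ^ 2 + A ^ 2 * (1 + A * M) * ‖F₂‖ ^ 2 * ‖u₁ - u₂‖ ^ 2 := by
    have hD : 0 < 1 + A * M := by positivity
    have h5 : 1 / (1 + A * M) * ‖F₁ - F₂‖ ^ 2 + A ^ 2 * (1 + A * M) * ‖F₂‖ ^ 2 * ‖u₁ - u₂‖ ^ 2
        - 2 * (A * ‖u₁ - u₂‖ * (‖F₂‖ * ‖F₁ - F₂‖))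
        = (‖F₁ - F₂‖ - (1 + A * M) * (A * ‖u₁ - u₂‖ * ‖F₂‖)) ^ 2 / (1 + A * M) := by
      field_simp
      ring
    have h6 : 0 ≤ (‖F₁ - F₂‖ - (1 + A * M) * (A * ‖u₁ - u₂‖ * ‖F₂‖)) ^ 2 / (1 + A * M) := by
      positivity
    linarith
  have h7 : -(A * ‖u₁ - u₂‖ * (‖F₂‖ * ‖F₁ - F₂‖))
      ≤ diffusionForm Ω ξ k u₁ F₂ (F₁ - F₂) - diffusionForm Ω ξ k u₂ F₂ (F₁ - F₂) := h2
  linarith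

end

/-! ### Energy balances of the three equations -/

section

variable {Ω : Set Plane} [IsFiniteMeasure (volume.restrict Ω)] {ξ k T : ℝ}

omit [IsFiniteMeasure (volume.restrict Ω)] in
theorem memLp_toFunL {V : Submodule ℝ (Pair Ω)} {w : ℝ → V} (hw : MemLp w 2 (timeMeasure T)) :
    MemLp (fun t => toFunL V (w t)) 2 (timeMeasure T) :=
  (toFunL V).comp_memLp' hw

omit [IsFiniteMeasure (volume.restrict Ω)] in
theorem memLp_gradL {V : Submodule ℝ (Pair Ω)} {w : ℝ → V} (hw : MemLp w 2 (timeMeasure T)) :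
    MemLp (fun t => gradL V (w t)) 2 (timeMeasure T) :=
  (gradL V).comp_memLp' hw

/-- The energy balance for `I₁ - I₂`: `R` is the rate of change of
`‖I₁ - I₂‖²`. -/
theorem image_balance (hT : 0 < T) (hξ : 0 < ξ) {w₀ : Plane → ℝ} (hw₀ : StronglyMeasurable w₀)
    {I₁ I₂ u₁ u₂ : ℝ → H1 Ω} {v₁ v₂ : ℝ → H10 Ω} {I₁' I₂' : ℝ → (H1 Ω →L[ℝ] ℝ)}
    (hI₁ : MemW T I₁ I₁') (hI₂ : MemW T I₂ I₂')
    (hu₁ : MemLp u₁ 2 (timeMeasure T)) (hu₂ : MemLp u₂ 2 (timeMeasure T))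
    (hv₁ : MemLp v₁ 2 (timeMeasure T)) (hv₂ : MemLp v₂ 2 (timeMeasure T))
    (hi₁ : HasInitialValue T I₁ w₀) (hi₂ : HasInitialValue T I₂ w₀)
    (he₁ : ∀ Ψ : ℝ → H1 Ω, MemLp Ψ 2 (timeMeasure T) →
      (∫ t in Ioo 0 T, I₁' t (Ψ t))
        + (∫ t in Ioo 0 T, ∫ x in Ω,
            diffusivity Ω ξ k (toFun (u₁ t)) x * inner ℝ (grad (I₁ t) x) (grad (Ψ t) x))
        + 2 * (∫ t in Ioo 0 T, ∫ x in Ω, toFun (v₁ t) x * toFun (Ψ t) x) = 0)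
    (he₂ : ∀ Ψ : ℝ → H1 Ω, MemLp Ψ 2 (timeMeasure T) →
      (∫ t in Ioo 0 T, I₂' t (Ψ t))
        + (∫ t in Ioo 0 T, ∫ x in Ω,
            diffusivity Ω ξ k (toFun (u₂ t)) x * inner ℝ (grad (I₂ t) x) (grad (Ψ t) x))
        + 2 * (∫ t in Ioo 0 T, ∫ x in Ω, toFun (v₂ t) x * toFun (Ψ t) x) = 0)
    {M A : ℝ} (hM : ∀ᵐ t ∂(timeMeasure T), ‖toFunL (H1 Ω) (u₁ t)‖ ≤ M)
    (hA : A = (ξ * Real.sqrt (2 * Real.pi))⁻¹ * sqrtVol Ω / k ^ 2) :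
    ∃ R : ℝ → ℝ, Integrable R (timeMeasure T) ∧
      (∀ᵐ t ∂(timeMeasure T), ‖toFunL (H1 Ω) (I₁ t - I₂ t)‖ ^ 2 = ∫ s in (0 : ℝ)..t, R s) ∧
      ∀ᵐ t ∂(timeMeasure T), R t ≤ -(1 / (1 + A * M)) * ‖gradL (H1 Ω) (I₁ t - I₂ t)‖ ^ 2
        + A ^ 2 * (1 + A * M) * ‖gradL (H1 Ω) (I₂ t)‖ ^ 2 * ‖toFunL (H1 Ω) (u₁ t - u₂ t)‖ ^ 2
        + 2 * ‖toFunL (H10 Ω) (v₁ t - v₂ t)‖ ^ 2 + 2 * ‖toFunL (H1 Ω) (I₁ t - I₂ t)‖ ^ 2 := by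
  let R : (ℝ → H1 Ω) → (ℝ → H1 Ω) → (ℝ → H10 Ω) → ℝ → H1 Ω → ℝ := fun I u v s ψ =>
    -diffusionForm Ω ξ k (toFunL _ (u s)) (gradL _ (I s)) (gradL _ ψ)
      - 2 * inner ℝ (toFunL _ (v s)) (toFunL _ ψ)
  have hd : ∀ {I u Ψ : ℝ → H1 Ω}, MemLp I 2 (timeMeasure T) → MemLp u 2 (timeMeasure T) →
      MemLp Ψ 2 (timeMeasure T) → Integrable (fun t => diffusionForm Ω ξ k (toFunL _ (u t))
        (gradL _ (I t)) (gradL _ (Ψ t))) (timeMeasure T) := fun hI hu hΨ =>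
    integrable_diffusionForm hξ (memLp_toFunL hu) (memLp_gradL hI) (memLp_gradL hΨ)
  have hv : ∀ {v : ℝ → H10 Ω} {Ψ : ℝ → H1 Ω}, MemLp v 2 (timeMeasure T) →
      MemLp Ψ 2 (timeMeasure T) → Integrable (fun t => inner ℝ (toFunL _ (v t)) (toFunL _ (Ψ t)))
        (timeMeasure T) := fun hv hΨ => (memLp_toFunL hv).integrable_inner (memLp_toFunL hΨ)
  have hR0 : ∀ I u v s, R I u v s 0 = 0 := by
    intro I u v s
    simp only [R, map_zero, diffusionForm_zero_right, inner_zero_right]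
    simp
  have hRi : ∀ {I u Ψ : ℝ → H1 Ω} {v : ℝ → H10 Ω}, MemLp I 2 (timeMeasure T) →
      MemLp u 2 (timeMeasure T) → MemLp v 2 (timeMeasure T) → MemLp Ψ 2 (timeMeasure T) →
      Integrable (fun s => R I u v s (Ψ s)) (timeMeasure T) := fun h1 h2 h3 h4 =>
    (hd h1 h2 h4).neg.sub ((hv h3 h4).const_mul 2)
  have hRe : ∀ {I u Ψ : ℝ → H1 Ω} {v : ℝ → H10 Ω} {X : ℝ}, MemLp I 2 (timeMeasure T) →
      MemLp u 2 (timeMeasure T) → MemLp v 2 (timeMeasure T) → MemLp Ψ 2 (timeMeasure T) →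
      X + (∫ t in Ioo 0 T, ∫ x in Ω,
            diffusivity Ω ξ k (toFun (u t)) x * inner ℝ (grad (I t) x) (grad (Ψ t) x))
        + 2 * (∫ t in Ioo 0 T, ∫ x in Ω, toFun (v t) x * toFun (Ψ t) x) = 0 →
      X = ∫ s in Ioo 0 T, R I u v s (Ψ s) := by
    intro I u Ψ v X h1 h2 h3 h4 hX
    have e : ∫ s in Ioo 0 T, R I u v s (Ψ s)
        = -(∫ t in Ioo 0 T, diffusionForm Ω ξ k (toFunL _ (u t)) (gradL _ (I t)) (gradL _ (Ψ t)))
          - 2 * ∫ t in Ioo 0 T, inner ℝ (toFunL _ (v t)) (toFunL _ (Ψ t)) := by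
      rw [← integral_neg, ← integral_const_mul]
      exact integral_sub (hd h1 h2 h4).neg ((hv h3 h4).const_mul 2)
    simp only [L2_inner_eq] at e
    rw [e]
    change X + (∫ t in Ioo 0 T, diffusionForm Ω ξ k (toFunL _ (u t)) (gradL _ (I t))
      (gradL _ (Ψ t))) + 2 * (∫ t in Ioo 0 T, ∫ x in Ω, toFunL _ (v t) x * toFunL _ (Ψ t) x) = 0
      at hX
    linarith
  have hz : MemLp (fun s => I₁ s - I₂ s) 2 (timeMeasure T) := hI₁.memLp.sub hI₂.memLp
  have hi₁' := hRi hI₁.memLp hu₁ hv₁ hz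
  have hi₂' := hRi hI₂.memLp hu₂ hv₂ hz
  refine ⟨fun s => 2 * (R I₁ u₁ v₁ s (I₁ s - I₂ s) - R I₂ u₂ v₂ s (I₁ s - I₂ s)),
    (hi₁'.sub hi₂').const_mul 2, ?_, ?_⟩
  · exact ae_sq_norm_toFunL_sub_eq hT hI₁ hI₂ hw₀ hi₁ hi₂ (hR0 _ _ _) (hR0 _ _ _) hi₁' hi₂'
      (fun Ψ hΨ => hRe hI₁.memLp hu₁ hv₁ hΨ (he₁ Ψ hΨ))
      (fun Ψ hΨ => hRe hI₂.memLp hu₂ hv₂ hΨ (he₂ Ψ hΨ))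
  · filter_upwards [hM] with t ht
    have h1 := diffusionForm_difference_le (k := k) hξ (u₂ := toFunL _ (u₂ t))
      (gradL _ (I₁ t)) (gradL _ (I₂ t)) ht hA
    have h2 := abs_le.1 (abs_real_inner_le_norm (toFunL _ (v₁ t - v₂ t)) (toFunL _ (I₁ t - I₂ t)))
    have h3 := two_mul_le_add_sq ‖toFunL _ (v₁ t - v₂ t)‖ ‖toFunL _ (I₁ t - I₂ t)‖
    have h4 : inner ℝ (toFunL _ (v₁ t - v₂ t)) (toFunL _ (I₁ t - I₂ t))
        = inner ℝ (toFunL _ (v₁ t)) (toFunL _ (I₁ t - I₂ t))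
          - inner ℝ (toFunL _ (v₂ t)) (toFunL _ (I₁ t - I₂ t)) := by
      rw [map_sub (toFunL (H10 Ω)), inner_sub_left]
    rw [← map_sub (gradL (H1 Ω)), ← map_sub (toFunL (H1 Ω))] at h1
    simp only [R]
    linarith [h2.1]

/-- The energy balance for `u₁ - u₂`. The quadratic source is
Lipschitz only on bounded sets, whence the factor `‖I₁‖ + ‖I₂‖`. -/
theorem edge_balance (hT : 0 < T) (hξ : 0 < ξ) {w₀ : Plane → ℝ} (hw₀ : StronglyMeasurable w₀)
    {h : ℝ → ℝ} {c_h : ℝ≥0} (hLip : LipschitzOnWith c_h h (Ici 0))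
    (hbd : ∀ s, 0 ≤ s → |h s| ≤ 1)
    {I₁ I₂ u₁ u₂ : ℝ → H1 Ω} {u₁' u₂' : ℝ → (H1 Ω →L[ℝ] ℝ)}
    (hI₁ : MemLp I₁ 2 (timeMeasure T)) (hI₂ : MemLp I₂ 2 (timeMeasure T))
    (hu₁ : MemW T u₁ u₁') (hu₂ : MemW T u₂ u₂')
    (hi₁ : HasInitialValue T u₁ w₀) (hi₂ : HasInitialValue T u₂ w₀)
    (he₁ : ∀ Ψ : ℝ → H1 Ω, MemLp Ψ 2 (timeMeasure T) →
      (∫ t in Ioo 0 T, u₁' t (Ψ t))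
        - (∫ t in Ioo 0 T, ∫ x in Ω,
            h (‖gradient (gconv Ω ξ (toFun (I₁ t))) x‖ ^ 2) * toFun (Ψ t) x)
        + (∫ t in Ioo 0 T, ∫ x in Ω, toFun (u₁ t) x * toFun (Ψ t) x)
        + (∫ t in Ioo 0 T, ∫ x in Ω, inner ℝ (grad (u₁ t) x) (grad (Ψ t) x)) = 0)
    (he₂ : ∀ Ψ : ℝ → H1 Ω, MemLp Ψ 2 (timeMeasure T) →
      (∫ t in Ioo 0 T, u₂' t (Ψ t))
        - (∫ t in Ioo 0 T, ∫ x in Ω,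
            h (‖gradient (gconv Ω ξ (toFun (I₂ t))) x‖ ^ 2) * toFun (Ψ t) x)
        + (∫ t in Ioo 0 T, ∫ x in Ω, toFun (u₂ t) x * toFun (Ψ t) x)
        + (∫ t in Ioo 0 T, ∫ x in Ω, inner ℝ (grad (u₂ t) x) (grad (Ψ t) x)) = 0)
    {K : ℝ} (hK : K = c_h * ((ξ * Real.sqrt (2 * Real.pi))⁻¹ / ξ * sqrtVol Ω) ^ 2 * sqrtVol Ω) :
    ∃ R : ℝ → ℝ, Integrable R (timeMeasure T) ∧
      (∀ᵐ t ∂(timeMeasure T), ‖toFunL (H1 Ω) (u₁ t - u₂ t)‖ ^ 2 = ∫ s in (0 : ℝ)..t, R s) ∧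
      ∀ᵐ t ∂(timeMeasure T), R t ≤ -2 * ‖gradL (H1 Ω) (u₁ t - u₂ t)‖ ^ 2
        + K * (‖toFunL (H1 Ω) (I₁ t)‖ + ‖toFunL (H1 Ω) (I₂ t)‖)
          * (‖toFunL (H1 Ω) (I₁ t - I₂ t)‖ ^ 2 + ‖toFunL (H1 Ω) (u₁ t - u₂ t)‖ ^ 2) := by
  let R : (ℝ → H1 Ω) → (ℝ → H1 Ω) → ℝ → H1 Ω → ℝ := fun I u s ψ =>
    sourceForm Ω ξ h (toFunL _ (I s)) (toFunL _ ψ) - inner ℝ (toFunL _ (u s)) (toFunL _ ψ)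
      - inner ℝ (gradL _ (u s)) (gradL _ ψ)
  have hs : ∀ {I Ψ : ℝ → H1 Ω}, MemLp I 2 (timeMeasure T) → MemLp Ψ 2 (timeMeasure T) →
      Integrable (fun t => sourceForm Ω ξ h (toFunL _ (I t)) (toFunL _ (Ψ t))) (timeMeasure T) :=
    fun hI hΨ => integrable_sourceForm hξ hLip hbd (memLp_toFunL hI) (memLp_toFunL hΨ)
  have hv : ∀ {v Ψ : ℝ → H1 Ω}, MemLp v 2 (timeMeasure T) →
      MemLp Ψ 2 (timeMeasure T) → Integrable (fun t => inner ℝ (toFunL _ (v t)) (toFunL _ (Ψ t)))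
        (timeMeasure T) := fun hv hΨ => (memLp_toFunL hv).integrable_inner (memLp_toFunL hΨ)
  have hg : ∀ {v Ψ : ℝ → H1 Ω}, MemLp v 2 (timeMeasure T) →
      MemLp Ψ 2 (timeMeasure T) → Integrable (fun t => inner ℝ (gradL _ (v t)) (gradL _ (Ψ t)))
        (timeMeasure T) := fun hv hΨ => (memLp_gradL hv).integrable_inner (memLp_gradL hΨ)
  have hR0 : ∀ I u s, R I u s 0 = 0 := by
    intro I u s
    simp only [R, map_zero, sourceForm_zero_right hbd, inner_zero_right]
    simp
  have hRi : ∀ {I u Ψ : ℝ → H1 Ω}, MemLp I 2 (timeMeasure T) →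
      MemLp u 2 (timeMeasure T) → MemLp Ψ 2 (timeMeasure T) →
      Integrable (fun s => R I u s (Ψ s)) (timeMeasure T) := fun h1 h2 h4 =>
    ((hs h1 h4).sub (hv h2 h4)).sub (hg h2 h4)
  have hRe : ∀ {I u Ψ : ℝ → H1 Ω} {X : ℝ}, MemLp I 2 (timeMeasure T) →
      MemLp u 2 (timeMeasure T) → MemLp Ψ 2 (timeMeasure T) →
      X - (∫ t in Ioo 0 T, ∫ x in Ω,
            h (‖gradient (gconv Ω ξ (toFun (I t))) x‖ ^ 2) * toFun (Ψ t) x)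
        + (∫ t in Ioo 0 T, ∫ x in Ω, toFun (u t) x * toFun (Ψ t) x)
        + (∫ t in Ioo 0 T, ∫ x in Ω, inner ℝ (grad (u t) x) (grad (Ψ t) x)) = 0 →
      X = ∫ s in Ioo 0 T, R I u s (Ψ s) := by
    intro I u Ψ X h1 h2 h4 hX
    have e : ∫ s in Ioo 0 T, R I u s (Ψ s)
        = (∫ t in Ioo 0 T, sourceForm Ω ξ h (toFunL _ (I t)) (toFunL _ (Ψ t)))
          - (∫ t in Ioo 0 T, inner ℝ (toFunL _ (u t)) (toFunL _ (Ψ t)))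
          - ∫ t in Ioo 0 T, inner ℝ (gradL _ (u t)) (gradL _ (Ψ t)) := by
      rw [← integral_sub (hs h1 h4) (hv h2 h4)]
      exact integral_sub ((hs h1 h4).sub (hv h2 h4)) (hg h2 h4)
    simp only [L2_inner_eq, L2.inner_def (E := Plane)] at e
    rw [e]
    change X - (∫ t in Ioo 0 T, sourceForm Ω ξ h (toFunL _ (I t)) (toFunL _ (Ψ t)))
      + (∫ t in Ioo 0 T, ∫ x in Ω, toFunL _ (u t) x * toFunL _ (Ψ t) x)
      + (∫ t in Ioo 0 T, ∫ x in Ω, inner ℝ (gradL _ (u t) x) (gradL _ (Ψ t) x)) = 0 at hX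
    linarith
  have hz : MemLp (fun s => u₁ s - u₂ s) 2 (timeMeasure T) := hu₁.memLp.sub hu₂.memLp
  have hi₁' := hRi hI₁ hu₁.memLp hz
  have hi₂' := hRi hI₂ hu₂.memLp hz
  refine ⟨fun s => 2 * (R I₁ u₁ s (u₁ s - u₂ s) - R I₂ u₂ s (u₁ s - u₂ s)),
    (hi₁'.sub hi₂').const_mul 2, ?_, ae_of_all _ fun t => ?_⟩
  · exact ae_sq_norm_toFunL_sub_eq hT hu₁ hu₂ hw₀ hi₁ hi₂ (hR0 _ _) (hR0 _ _) hi₁' hi₂'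
      (fun Ψ hΨ => hRe hI₁ hu₁.memLp hΨ (he₁ Ψ hΨ))
      (fun Ψ hΨ => hRe hI₂ hu₂.memLp hΨ (he₂ Ψ hΨ))
  · have h1 := (abs_le.1 (abs_sourceForm_sub_le hξ hLip hbd (toFunL _ (I₁ t)) (toFunL _ (I₂ t))
      (toFunL _ (u₁ t - u₂ t)))).2
    rw [← map_sub (toFunL (H1 Ω))] at h1
    have e1 : inner ℝ (toFunL _ (u₁ t)) (toFunL _ (u₁ t - u₂ t))
        - inner ℝ (toFunL _ (u₂ t)) (toFunL _ (u₁ t - u₂ t))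
          = ‖toFunL (H1 Ω) (u₁ t - u₂ t)‖ ^ 2 := by
      rw [← inner_sub_left, ← map_sub (toFunL (H1 Ω)), real_inner_self_eq_norm_sq]
    have e2 : inner ℝ (gradL _ (u₁ t)) (gradL _ (u₁ t - u₂ t))
        - inner ℝ (gradL _ (u₂ t)) (gradL _ (u₁ t - u₂ t))
          = ‖gradL (H1 Ω) (u₁ t - u₂ t)‖ ^ 2 := by
      rw [← inner_sub_left, ← map_sub (gradL (H1 Ω)), real_inner_self_eq_norm_sq]
    have hK0 : 0 ≤ K := by
      have := sqrtVol_nonneg Ω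
      rw [hK]
      positivity
    have h2 := mul_le_mul_of_nonneg_left
      (two_mul_le_add_sq ‖toFunL _ (I₁ t - I₂ t)‖ ‖toFunL _ (u₁ t - u₂ t)‖)
      (mul_nonneg hK0 (add_nonneg (norm_nonneg (toFunL _ (I₁ t))) (norm_nonneg (toFunL _ (I₂ t)))))
    have h3 := sq_nonneg ‖toFunL (H1 Ω) (u₁ t - u₂ t)‖
    have e3 : (c_h : ℝ) * ((ξ * Real.sqrt (2 * Real.pi))⁻¹ / ξ * sqrtVol Ω) ^ 2
        * (‖toFunL _ (I₁ t - I₂ t)‖ * (‖toFunL _ (I₁ t)‖ + ‖toFunL _ (I₂ t)‖))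
        * (sqrtVol Ω * ‖toFunL _ (u₁ t - u₂ t)‖)
        = K * (‖toFunL _ (I₁ t)‖ + ‖toFunL _ (I₂ t)‖)
          * (2 * ‖toFunL _ (I₁ t - I₂ t)‖ * ‖toFunL _ (u₁ t - u₂ t)‖) / 2 := by
      rw [hK]; ring
    rw [e3] at h1
    simp only [R]
    linarith

omit [IsFiniteMeasure (volume.restrict Ω)] in
/-- The energy balance for `v₁ - v₂`. -/
theorem texture_balance (hT : 0 < T) {I₀ : H1 Ω} {I₁ I₂ : ℝ → H1 Ω} {v₁ v₂ : ℝ → H10 Ω}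
    {v₁' v₂' : ℝ → (H10 Ω →L[ℝ] ℝ)}
    (hI₁ : MemLp I₁ 2 (timeMeasure T)) (hI₂ : MemLp I₂ 2 (timeMeasure T))
    (hv₁ : MemW T v₁ v₁') (hv₂ : MemW T v₂ v₂')
    (hi₁ : HasInitialValue T v₁ fun _ => 0) (hi₂ : HasInitialValue T v₂ fun _ => 0)
    (he₁ : ∀ Φ : ℝ → H10 Ω, MemLp Φ 2 (timeMeasure T) →
      (∫ t in Ioo 0 T, v₁' t (Φ t))
        + (∫ t in Ioo 0 T, ∫ x in Ω, inner ℝ (grad (v₁ t) x) (grad (Φ t) x))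
        + (∫ t in Ioo 0 T, ∫ x in Ω, (toFun I₀ x - toFun (I₁ t) x) * toFun (Φ t) x) = 0)
    (he₂ : ∀ Φ : ℝ → H10 Ω, MemLp Φ 2 (timeMeasure T) →
      (∫ t in Ioo 0 T, v₂' t (Φ t))
        + (∫ t in Ioo 0 T, ∫ x in Ω, inner ℝ (grad (v₂ t) x) (grad (Φ t) x))
        + (∫ t in Ioo 0 T, ∫ x in Ω, (toFun I₀ x - toFun (I₂ t) x) * toFun (Φ t) x) = 0) :
    ∃ R : ℝ → ℝ, Integrable R (timeMeasure T) ∧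
      (∀ᵐ t ∂(timeMeasure T), ‖toFunL (H10 Ω) (v₁ t - v₂ t)‖ ^ 2 = ∫ s in (0 : ℝ)..t, R s) ∧
      ∀ᵐ t ∂(timeMeasure T), R t ≤ -2 * ‖gradL (H10 Ω) (v₁ t - v₂ t)‖ ^ 2
        + ‖toFunL (H1 Ω) (I₁ t - I₂ t)‖ ^ 2 + ‖toFunL (H10 Ω) (v₁ t - v₂ t)‖ ^ 2 := by
  let R : (ℝ → H1 Ω) → (ℝ → H10 Ω) → ℝ → H10 Ω → ℝ := fun I v s ψ =>
    -inner ℝ (gradL _ (v s)) (gradL _ ψ) - inner ℝ (toFunL _ (I₀ - I s)) (toFunL _ ψ)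
  have hg : ∀ {v Ψ : ℝ → H10 Ω}, MemLp v 2 (timeMeasure T) →
      MemLp Ψ 2 (timeMeasure T) → Integrable (fun t => inner ℝ (gradL _ (v t)) (gradL _ (Ψ t)))
        (timeMeasure T) := fun hv hΨ => (memLp_gradL hv).integrable_inner (memLp_gradL hΨ)
  have hv : ∀ {I : ℝ → H1 Ω} {Ψ : ℝ → H10 Ω}, MemLp I 2 (timeMeasure T) →
      MemLp Ψ 2 (timeMeasure T) → Integrable (fun t => inner ℝ (toFunL _ (I₀ - I t))
        (toFunL _ (Ψ t))) (timeMeasure T) := fun hI hΨ =>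
    (memLp_toFunL ((memLp_const I₀).sub hI)).integrable_inner (memLp_toFunL hΨ)
  have hR0 : ∀ I v s, R I v s 0 = 0 := by
    intro I v s
    simp only [R, map_zero, inner_zero_right]
    simp
  have hRi : ∀ {I : ℝ → H1 Ω} {v Ψ : ℝ → H10 Ω}, MemLp I 2 (timeMeasure T) →
      MemLp v 2 (timeMeasure T) → MemLp Ψ 2 (timeMeasure T) →
      Integrable (fun s => R I v s (Ψ s)) (timeMeasure T) := fun h1 h2 h4 =>
    (hg h2 h4).neg.sub (hv h1 h4)
  have hRe : ∀ {I : ℝ → H1 Ω} {v Ψ : ℝ → H10 Ω} {X : ℝ}, MemLp I 2 (timeMeasure T) →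
      MemLp v 2 (timeMeasure T) → MemLp Ψ 2 (timeMeasure T) →
      X + (∫ t in Ioo 0 T, ∫ x in Ω, inner ℝ (grad (v t) x) (grad (Ψ t) x))
        + (∫ t in Ioo 0 T, ∫ x in Ω, (toFun I₀ x - toFun (I t) x) * toFun (Ψ t) x) = 0 →
      X = ∫ s in Ioo 0 T, R I v s (Ψ s) := by
    intro I v Ψ X h1 h2 h4 hX
    have e : ∫ s in Ioo 0 T, R I v s (Ψ s)
        = -(∫ t in Ioo 0 T, inner ℝ (gradL _ (v t)) (gradL _ (Ψ t)))
          - ∫ t in Ioo 0 T, inner ℝ (toFunL _ (I₀ - I t)) (toFunL _ (Ψ t)) := by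
      rw [← integral_neg]
      exact integral_sub (hg h2 h4).neg (hv h1 h4)
    have e2 : ∀ t, ∫ x in Ω, (toFun I₀ x - toFun (I t) x) * toFun (Ψ t) x
        = inner ℝ (toFunL _ (I₀ - I t)) (toFunL _ (Ψ t)) := by
      intro t
      rw [L2_inner_eq, map_sub]
      refine integral_congr_ae ?_
      filter_upwards [Lp.coeFn_sub (toFunL _ I₀) (toFunL _ (I t))] with x hx
      rw [hx, Pi.sub_apply, toFunL_apply, toFunL_apply, toFunL_apply]
    simp only [e2] at hX
    simp only [L2.inner_def (E := Plane)] at e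
    rw [e]
    change X + (∫ t in Ioo 0 T, ∫ x in Ω, inner ℝ (gradL _ (v t) x) (gradL _ (Ψ t) x))
      + (∫ t in Ioo 0 T, inner ℝ (toFunL _ (I₀ - I t)) (toFunL _ (Ψ t))) = 0 at hX
    linarith
  have hz : MemLp (fun s => v₁ s - v₂ s) 2 (timeMeasure T) := hv₁.memLp.sub hv₂.memLp
  have hi₁' := hRi hI₁ hv₁.memLp hz
  have hi₂' := hRi hI₂ hv₂.memLp hz
  refine ⟨fun s => 2 * (R I₁ v₁ s (v₁ s - v₂ s) - R I₂ v₂ s (v₁ s - v₂ s)),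
    (hi₁'.sub hi₂').const_mul 2, ?_, ae_of_all _ fun t => ?_⟩
  · exact ae_sq_norm_toFunL_sub_eq hT hv₁ hv₂ stronglyMeasurable_const hi₁ hi₂ (hR0 _ _) (hR0 _ _)
      hi₁' hi₂' (fun Ψ hΨ => hRe hI₁ hv₁.memLp hΨ (he₁ Ψ hΨ))
      (fun Ψ hΨ => hRe hI₂ hv₂.memLp hΨ (he₂ Ψ hΨ))
  · have e1 : inner ℝ (toFunL _ (I₀ - I₂ t)) (toFunL _ (v₁ t - v₂ t))
        - inner ℝ (toFunL _ (I₀ - I₁ t)) (toFunL _ (v₁ t - v₂ t))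
          = inner ℝ (toFunL _ (I₁ t - I₂ t)) (toFunL _ (v₁ t - v₂ t)) := by
      rw [← inner_sub_left, ← map_sub (toFunL (H1 Ω)), sub_sub_sub_cancel_left]
    have e2 : inner ℝ (gradL _ (v₁ t)) (gradL _ (v₁ t - v₂ t))
        - inner ℝ (gradL _ (v₂ t)) (gradL _ (v₁ t - v₂ t))
          = ‖gradL (H10 Ω) (v₁ t - v₂ t)‖ ^ 2 := by
      rw [← inner_sub_left, ← map_sub (gradL (H10 Ω)), real_inner_self_eq_norm_sq]
    have h2 := (abs_le.1 (abs_real_inner_le_norm (toFunL _ (I₁ t - I₂ t))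
      (toFunL _ (v₁ t - v₂ t)))).2
    have h3 := two_mul_le_add_sq ‖toFunL _ (I₁ t - I₂ t)‖ ‖toFunL _ (v₁ t - v₂ t)‖
    simp only [R]
    linarith

end

/-! ### Uniqueness -/

/-- The coupled energy balances close: if `yI`, `yu`, `yv` are the primitives of the rates `RI`,
`Ru`, `Rv`, bounded in terms of `yI`, `yu`, `yv` up to dissipation terms, then all vanish. -/
theorem ae_eq_zero_of_balances {T : ℝ} (hT : 0 < T) {yI yu yv dI du dv a b RI Ru Rv : ℝ → ℝ} {ν : ℝ}
    (hν : 0 < ν) (hyI0 : ∀ t, 0 ≤ yI t) (hyu0 : ∀ t, 0 ≤ yu t) (hyv0 : ∀ t, 0 ≤ yv t)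
    (hdI0 : ∀ t, 0 ≤ dI t) (hdu0 : ∀ t, 0 ≤ du t) (hdv0 : ∀ t, 0 ≤ dv t)
    (ha0 : ∀ t, 0 ≤ a t) (hb0 : ∀ t, 0 ≤ b t)
    (hyI : Integrable yI (timeMeasure T)) (hyu : Integrable yu (timeMeasure T))
    (hyv : Integrable yv (timeMeasure T)) (hdI : Integrable dI (timeMeasure T))
    (hdu : Integrable du (timeMeasure T)) (hdv : Integrable dv (timeMeasure T))
    (ha : Integrable a (timeMeasure T)) (hb : Integrable b (timeMeasure T))
    (hRI : Integrable RI (timeMeasure T)) (hRu : Integrable Ru (timeMeasure T))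
    (hRv : Integrable Rv (timeMeasure T))
    (hRI1 : ∀ᵐ t ∂(timeMeasure T), yI t = ∫ s in (0 : ℝ)..t, RI s)
    (hRu1 : ∀ᵐ t ∂(timeMeasure T), yu t = ∫ s in (0 : ℝ)..t, Ru s)
    (hRv1 : ∀ᵐ t ∂(timeMeasure T), yv t = ∫ s in (0 : ℝ)..t, Rv s)
    (hRI2 : ∀ᵐ t ∂(timeMeasure T), RI t ≤ -ν * dI t + a t * yu t + 2 * yv t + 2 * yI t)
    (hRu2 : ∀ᵐ t ∂(timeMeasure T), Ru t ≤ -2 * du t + b t * (yI t + yu t))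
    (hRv2 : ∀ᵐ t ∂(timeMeasure T), Rv t ≤ -2 * dv t + yI t + yv t) :
    ∀ᵐ t ∂(timeMeasure T), (yI t = 0 ∧ dI t = 0) ∧ (yu t = 0 ∧ du t = 0) ∧ yv t = 0 ∧ dv t = 0 := by
  have hdi : Integrable (fun t => ν * dI t + 2 * du t + 2 * dv t) (timeMeasure T) :=
    ((hdI.const_mul ν).add (hdu.const_mul 2)).add (hdv.const_mul 2)
  have hyi : Integrable (fun t => yI t + yu t + yv t) (timeMeasure T) := (hyI.add hyu).add hyv
  have hαi : Integrable (fun t => a t + b t + 3) (timeMeasure T) :=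
    (ha.add hb).add (integrable_const 3)
  have hRIu : Integrable (fun t => RI t + Ru t) (timeMeasure T) := hRI.add hRu
  have hR : Integrable (fun t => RI t + Ru t + Rv t) (timeMeasure T) := hRIu.add hRv
  have hyR : ∀ᵐ t ∂(timeMeasure T),
      yI t + yu t + yv t = ∫ s in (0 : ℝ)..t, (RI s + Ru s + Rv s) := by
    filter_upwards [hRI1, hRu1, hRv1, ae_restrict_mem measurableSet_Ioo] with t h1 h2 h3 h4
    have j : ∀ {f : ℝ → ℝ}, Integrable f (timeMeasure T) → IntervalIntegrable f volume 0 t :=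
      fun hf => intervalIntegrable_of_timeMeasure hf ⟨le_rfl, hT.le⟩ (Ioo_subset_Icc_self h4)
    rw [intervalIntegral.integral_add (j hRIu) (j hRv),
      intervalIntegral.integral_add (j hRI) (j hRu), ← h1, ← h2, ← h3]
  have hy0 : ∀ t, 0 ≤ yI t + yu t + yv t := fun t =>
    add_nonneg (add_nonneg (hyI0 t) (hyu0 t)) (hyv0 t)
  have hd0 : ∀ t, 0 ≤ ν * dI t + 2 * du t + 2 * dv t := fun t => by
    linarith [mul_nonneg hν.le (hdI0 t), hdu0 t, hdv0 t]
  have hα0 : ∀ t, 0 ≤ a t + b t + 3 := fun t => by linarith [ha0 t, hb0 t]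
  have hαy : Integrable (fun t => (a t + b t + 3) * (yI t + yu t + yv t)) (timeMeasure T) := by
    obtain ⟨C, hC⟩ := isCompact_Icc.exists_bound_of_continuousOn
      (continuousOn_primitive_timeMeasure hR)
    refine hαi.mul_bdd (c := C) hyi.1 ?_
    filter_upwards [hyR, ae_restrict_mem measurableSet_Ioo] with t h1 h2
    rw [h1]
    exact hC t (Ioo_subset_Icc_self h2)
  have hle : ∀ᵐ t ∂(timeMeasure T), RI t + Ru t + Rv t + (ν * dI t + 2 * du t + 2 * dv t)
      ≤ (a t + b t + 3) * (yI t + yu t + yv t) := by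
    filter_upwards [hRI2, hRu2, hRv2] with t h1 h2 h3
    linarith [mul_nonneg (ha0 t) (hyI0 t), mul_nonneg (ha0 t) (hyv0 t),
      mul_nonneg (hb0 t) (hyv0 t), hyu0 t]
  have hG : ∀ᵐ t ∂(timeMeasure T),
      yI t + yu t + yv t + ∫ s in (0 : ℝ)..t, (ν * dI s + 2 * du s + 2 * dv s)
        ≤ ∫ s in (0 : ℝ)..t, (a s + b s + 3) * (yI s + yu s + yv s) := by
    filter_upwards [hyR, ae_restrict_mem measurableSet_Ioo] with t h1 h2
    have ht := Ioo_subset_Icc_self h2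
    have h0 : (0 : ℝ) ∈ Icc 0 T := ⟨le_rfl, hT.le⟩
    rw [h1, ← intervalIntegral.integral_add (intervalIntegrable_of_timeMeasure hR h0 ht)
      (intervalIntegrable_of_timeMeasure hdi h0 ht)]
    exact integral_zero_mono_ae (hR.add hdi) hαy hle ht
  obtain ⟨hyz, hdz⟩ := ae_eq_zero_of_le_integral_mul hT hαi (ae_of_all _ hα0) (ae_of_all _ hy0) hαy
    hdi (ae_of_all _ hd0) hG
  filter_upwards [hyz, hdz] with t h1 h2
  have p := hyI0 t
  have q := hyu0 t
  have r := hyv0 t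
  have p' := mul_nonneg hν.le (hdI0 t)
  have q' := hdu0 t
  have r' := hdv0 t
  refine ⟨⟨by linarith, ?_⟩, ⟨by linarith, by linarith⟩, by linarith, by linarith⟩
  exact (mul_eq_zero.1 (by linarith : ν * dI t = 0)).resolve_left hν.ne'

theorem _root_.MeasureTheory.MemLp.integrable_sq_norm {α E : Type*} [MeasurableSpace α]
    [NormedAddCommGroup E] {μ : Measure α} {f : α → E} (hf : MemLp f 2 μ) :
    Integrable (fun t => ‖f t‖ ^ 2) μ := by
  simpa [sq] using hf.integrable_norm_mul_norm hf

end CPDE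

theorem mainTheorem2
    (Ω : Set CPDE.Plane) (hΩ : IsOpen Ω) (hΩb : Bornology.IsBounded Ω)
    (T ξ k : ℝ) (hT : 0 < T) (hξ : 0 < ξ) (hk : 0 < k)
    (h : ℝ → ℝ) (c_h : ℝ≥0) (hLip : LipschitzOnWith c_h h (Set.Ici 0))
    (δ : ℝ) (hδ : 0 < δ) (hbd : ∀ s : ℝ, 0 ≤ s → δ ≤ h s ∧ h s ≤ 1)
    (I₀ : CPDE.H1 Ω)
    (I₁ u₁ I₂ u₂ : ℝ → CPDE.H1 Ω) (v₁ v₂ : ℝ → CPDE.H10 Ω)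
    (hsol₁ : CPDE.IsWeakSolution Ω T ξ k h I₀ I₁ u₁ v₁)
    (hsol₂ : CPDE.IsWeakSolution Ω T ξ k h I₀ I₂ u₂ v₂) :
    I₁ =ᵐ[volume.restrict (Set.Ioo 0 T)] I₂ ∧
    u₁ =ᵐ[volume.restrict (Set.Ioo 0 T)] u₂ ∧
    v₁ =ᵐ[volume.restrict (Set.Ioo 0 T)] v₂ := by
  open CPDE in
  have : IsFiniteMeasure (volume.restrict Ω) :=
    isFiniteMeasure_restrict.2 hΩb.measure_lt_top.ne
  have hb : ∀ s, 0 ≤ s → |h s| ≤ 1 := fun s hs =>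
    abs_le.2 ⟨by linarith [(hbd s hs).1], (hbd s hs).2⟩
  obtain ⟨I₁', u₁', v₁', ⟨mI₁, mu₁, mv₁⟩, eI₁, eu₁, ev₁, iI₁, iu₁, iv₁⟩ := hsol₁
  obtain ⟨I₂', u₂', v₂', ⟨mI₂, mu₂, mv₂⟩, eI₂, eu₂, ev₂, iI₂, iu₂, iv₂⟩ := hsol₂
  -- the bound on `u₁` keeps the diffusion coefficient `g(u₁)` away from zero
  obtain ⟨M, hM0, hM⟩ := mu₁.exists_ae_norm_le hT
  have hS := sqrtVol_nonneg Ω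
  obtain ⟨A, hA⟩ : ∃ A, A = (ξ * Real.sqrt (2 * Real.pi))⁻¹ * sqrtVol Ω / k ^ 2 := ⟨_, rfl⟩
  have hA0 : 0 ≤ A := by rw [hA]; positivity
  obtain ⟨K, hK⟩ : ∃ K, K = c_h * ((ξ * Real.sqrt (2 * Real.pi))⁻¹ / ξ * sqrtVol Ω) ^ 2
    * sqrtVol Ω := ⟨_, rfl⟩
  have hK0 : 0 ≤ K := by rw [hK]; positivity
  have hw₀ : StronglyMeasurable (gconv Ω ξ fun y => ‖grad I₀ y‖ ^ 2) :=
    stronglyMeasurable_gconv hξ ((Lp.stronglyMeasurable (grad I₀)).norm.pow 2)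
  obtain ⟨RI, hRI, hRI1, hRI2⟩ := image_balance hT hξ (Lp.stronglyMeasurable (toFun I₀)) mI₁ mI₂
    mu₁.memLp mu₂.memLp mv₁.memLp mv₂.memLp iI₁ iI₂ eI₁ eI₂ hM hA
  obtain ⟨Ru, hRu, hRu1, hRu2⟩ := edge_balance hT hξ hw₀ hLip hb mI₁.memLp mI₂.memLp mu₁ mu₂
    iu₁ iu₂ eu₁ eu₂ hK
  obtain ⟨Rv, hRv, hRv1, hRv2⟩ := texture_balance hT mI₁.memLp mI₂.memLp mv₁ mv₂ iv₁ iv₂ ev₁ ev₂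
  have mI := mI₁.memLp.sub mI₂.memLp
  have mu := mu₁.memLp.sub mu₂.memLp
  have mv := mv₁.memLp.sub mv₂.memLp
  have ha : Integrable (fun t => A ^ 2 * (1 + A * M) * ‖gradL (H1 Ω) (I₂ t)‖ ^ 2)
      (timeMeasure T) := (memLp_gradL mI₂.memLp).integrable_sq_norm.const_mul _
  have hbi : Integrable (fun t => K * (‖toFunL (H1 Ω) (I₁ t)‖ + ‖toFunL (H1 Ω) (I₂ t)‖))
      (timeMeasure T) :=
    (((memLp_toFunL mI₁.memLp).integrable (by norm_num)).norm.add
      ((memLp_toFunL mI₂.memLp).integrable (by norm_num)).norm).const_mul K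
  have key := ae_eq_zero_of_balances hT (ν := 1 / (1 + A * M)) (by positivity)
    (fun t => sq_nonneg _) (fun t => sq_nonneg _) (fun t => sq_nonneg _)
    (fun t => sq_nonneg _) (fun t => sq_nonneg _) (fun t => sq_nonneg _)
    (fun t => by positivity) (fun t => by positivity)
    (memLp_toFunL mI).integrable_sq_norm (memLp_toFunL mu).integrable_sq_norm
    (memLp_toFunL mv).integrable_sq_norm (memLp_gradL mI).integrable_sq_norm
    (memLp_gradL mu).integrable_sq_norm (memLp_gradL mv).integrable_sq_norm
    ha hbi hRI hRu hRv hRI1 hRu1 hRv1 hRI2 hRu2 hRv2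
  refine ⟨?_, ?_, ?_⟩
  · filter_upwards [key] with t ht using eq_of_norm_sub_eq_zero ht.1.1 ht.1.2
  · filter_upwards [key] with t ht using eq_of_norm_sub_eq_zero ht.2.1.1 ht.2.1.2
  · filter_upwards [key] with t ht using eq_of_norm_sub_eq_zero ht.2.2.1 ht.2.2.2
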